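/- Let $G$ be a compact Lie group with normalised Haar measure, let $\mathrm{VN}_R(G)$ be the von Neumann algebra on $L^2(G)$ generated by the right translations $\pi_R(g)f(x)=f(xg)$, $g\in G$, and let $\tau$ be its canonical (Plancherel) trace, given on positive $T\in\mathrm{VN}_R(G)$ by $\tau(T)=\|f\|_{L^2(G)}^2$ if $T^{1/2}h=h*f$ for all $h\in L^2(G)$ with some $f\in L^2(G)$, and by $\tau(T)=\infty$ otherwise. For a closed densely defined operator $A$ on $L^2(G)$ affiliated with $\mathrm{VN}_R(G)$ put $$\mu_t(A)=\inf\{\lambda\ge 0:\ \tau(E_{(\lambda,\infty)}(|A|))\le t\},\qquad \|A\|_{L^{r,\infty}(\mathrm{VN}_R(G))}=\sup_{t>0}t^{1/r}\mu_t(A),$$ where $E_{(\lambda,\infty)}(|A|)$ is the spectral projection of $|A|=(A^*A)^{1/2}$ and $\inf\emptyset=\infty$. Call $A$ a left Fourier multiplier on $G$ if it is affiliated with $\mathrm{VN}_R(G)$ and $\tau$-measurable, that is, for every $\varepsilon>0$ there is a projection $P\in\mathrm{VN}_R(G)$ with range in the domain of $A$ and $\tau(1-P)\le\varepsilon$. Let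 $\widehat G$ be the set of equivalence classes of continuous irreducible unitary representations of $G$, each represented by a unitary matrix valued function $\xi$ of size $d_\xi$. Let $1<p\le 2\le q<\infty$, $p\ne q$, $\frac1r=\frac1p-\frac1q$, and let $A$ be a closed densely defined operator on $L^2(G)$ affiliated with $\mathrm{VN}_R(G)$; in particular, $A$ may be any left Fourier multiplier. Then for every $\xi$ the matrix coefficients of $\xi$ lie in the domain of $A$ and are mapped by $A$ to continuous functions, so that the global symbol $\sigma_A(\xi)=\xi^*(g)\,(A\xi)(g)\big|_{g=e}\in\mathbb C^{d_\xi\times d_\xi}$ is well defined, and, with the operator norm $\|\sigma_A(\xi)\|$ on $\mathbb C^{d_\xi}$, $$\|A\|_{L^{r,\infty}(\mathrm{VN}_R(G))}\ \le\ \sup_{s>0}\, s\Big(\sum_{\xi\in\widehat G:\ \|\sigma_A(\xi)\|\ge s}d_\xi^2\Big)^{\frac1p-\frac1q},$$ both sides being taken in $[0,\infty]$. Moreover, if the right-hand side is finite, then $A$ is $\tau$-measurable, i.e. a left Fourier multiplier. -/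

import Mathlib

open MeasureTheory
open scoped ENNReal NNReal ContDiff

section OperatorTheory

variable {H : Type*} [NormedAddCommGroup H] [InnerProductSpace ℂ H] [CompleteSpace H]

/-- The von Neumann algebra generated by a set of bounded operators: its double commutant (the
commutant of a set here being that of the set together with the adjoints of its elements). -/
noncomputable def generatedVNA (s : Set (H →L[ℂ] H)) : VonNeumannAlgebra H where
  toStarSubalgebra := StarSubalgebra.centralizer ℂ (StarSubalgebra.centralizer ℂ s : Set (H →L[ℂ] H))
  centralizer_centralizer' := by
    have h := StarSubalgebra.coe_centralizer ℂ
      (StarSubalgebra.centralizer ℂ s : Set (H →L[ℂ] H))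
    change Set.centralizer (Set.centralizer (SetLike.coe (StarSubalgebra.centralizer ℂ _))) =
      SetLike.coe (StarSubalgebra.centralizer ℂ _)
    rw [h, Set.centralizer_centralizer_centralizer]

/-- An (in general unbounded) operator `A` is affiliated with the von Neumann algebra `M`: it is
closed, densely defined and `U A U⁻¹ = A` for every unitary `U` in the commutant of `M`.
(The inclusions `U A ⊆ A U` for all `U`, in particular for `U` and `U⁻¹`, give the equality.) -/
def IsAffiliated (M : VonNeumannAlgebra H) (A : H →ₗ.[ℂ] H) : Prop :=
  A.IsClosed ∧ Dense (A.domain : Set H) ∧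
    ∀ U ∈ M.commutant, U ∈ unitary (H →L[ℂ] H) →
      ∀ x : A.domain, ∃ h : U x ∈ A.domain, A ⟨U x, h⟩ = U (A x)

/-- `A` is `τ`-measurable with respect to `M`: it is affiliated with `M`, and for every `ε > 0`
there is an orthogonal projection `P` in `M` with range inside the domain of `A` and
`τ (1 - P) ≤ ε`. -/
def IsTauMeasurable (M : VonNeumannAlgebra H) (τ : (H →L[ℂ] H) → ℝ≥0∞) (A : H →ₗ.[ℂ] H) : Prop :=
  IsAffiliated M A ∧
    ∀ ε : ℝ, 0 < ε → ∃ P ∈ M, IsStarProjection P ∧ (∀ x, P x ∈ A.domain) ∧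
      τ (1 - P) ≤ ENNReal.ofReal ε

/-- `R` is a bounded everywhere defined right inverse of `1 + A* A`, i.e. `R = (1 + A* A)⁻¹`. -/
def IsInvOneAddAdjMul (A : H →ₗ.[ℂ] H) (R : H →L[ℂ] H) : Prop :=
  ∀ x : H, ∃ (h : R x ∈ A.domain) (h' : A ⟨R x, h⟩ ∈ A.adjoint.domain),
    R x + A.adjoint ⟨A ⟨R x, h⟩, h'⟩ = x

/-- For a closed densely defined operator `A` the operator `(1 + A* A)⁻¹` exists and is unique. -/
theorem existsUnique_isInvOneAddAdjMul (A : H →ₗ.[ℂ] H) (hc : A.IsClosed)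
    (hd : Dense (A.domain : Set H)) : ∃! R : H →L[ℂ] H, IsInvOneAddAdjMul A R := by
  let e := WithLp.prodContinuousLinearEquiv 2 ℂ H H
  let K : Submodule ℂ (WithLp 2 (H × H)) := A.graph.comap e.toLinearMap
  have hK : IsClosed (K : Set (WithLp 2 (H × H))) := hc.preimage e.continuous
  have : CompleteSpace K := hK.completeSpace_coe
  let R : H →L[ℂ] H := (ContinuousLinearMap.fst ℂ H H) ∘L (e : WithLp 2 (H × H) →L[ℂ] H × H) ∘L
    K.starProjection ∘L (e.symm : H × H →L[ℂ] WithLp 2 (H × H)) ∘L (ContinuousLinearMap.inl ℂ H H)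
  have hR : IsInvOneAddAdjMul A R := by
    intro x
    set v : WithLp 2 (H × H) := e.symm (x, 0) with hv
    set w := K.starProjection v with hw
    have hRx : R x = w.fst := rfl
    have hwK : w ∈ K := K.starProjection_apply_mem v
    have hwg : (w.fst, w.snd) ∈ A.graph := hwK
    obtain ⟨y, hy1, hy2⟩ := (LinearPMap.mem_graph_iff A).1 hwg
    simp only at hy1 hy2
    have hmem : R x ∈ A.domain := by rw [hRx, ← hy1]; exact y.2
    have hA : A ⟨R x, hmem⟩ = w.snd := by
      rw [← hy2]; congr 1; exact Subtype.ext (hRx.trans hy1.symm)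
    have horth : ∀ z : A.domain, inner ℂ (x - w.fst) (z : H) = inner ℂ (w.snd) (A z) := by
      intro z
      have hz : e.symm ((z : H), A z) ∈ K := by
        change ((z : H), A z) ∈ A.graph
        exact A.mem_graph z
      have h0 := (K.mem_orthogonal' _).1 (K.sub_starProjection_mem_orthogonal v) _ hz
      rw [← hw] at h0
      have h1 : inner ℂ (x - w.fst) (z : H) + inner ℂ (0 - w.snd) (A z) = 0 := h0
      rw [zero_sub, inner_neg_left] at h1
      linear_combination h1
    have hmem' : A ⟨R x, hmem⟩ ∈ A.adjoint.domain := by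
      rw [hA]; exact LinearPMap.mem_adjoint_domain_of_exists _ ⟨_, horth⟩
    refine ⟨hmem, hmem', ?_⟩
    have h2 : A.adjoint ⟨A ⟨R x, hmem⟩, hmem'⟩ = x - w.fst := by
      apply LinearPMap.adjoint_apply_eq hd
      intro z
      rw [horth z]
      simp only [hA]
    rw [h2, hRx]; abel
  refine ⟨R, hR, fun S hS => ?_⟩
  ext x
  obtain ⟨h1, h1', e1⟩ := hS x
  obtain ⟨h2, h2', e2⟩ := hR x
  have key : ∀ u v : A.domain, ∀ (hu : A u ∈ A.adjoint.domain) (hv : A v ∈ A.adjoint.domain),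
      (u : H) + A.adjoint ⟨A u, hu⟩ = (v : H) + A.adjoint ⟨A v, hv⟩ → (u : H) = v := by
    intro u v hu hv huv
    have f1 := LinearPMap.adjoint_isFormalAdjoint hd ⟨A u, hu⟩ (u - v)
    have f2 := LinearPMap.adjoint_isFormalAdjoint hd ⟨A v, hv⟩ (u - v)
    have f3 : inner ℂ (A.adjoint ⟨A u, hu⟩ - A.adjoint ⟨A v, hv⟩) ((u - v : A.domain) : H)
        = inner ℂ (A (u - v)) (A (u - v)) := by
      rw [inner_sub_left, f1, f2, ← inner_sub_left, ← LinearPMap.map_sub]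
    have f4 : A.adjoint ⟨A u, hu⟩ - A.adjoint ⟨A v, hv⟩ = -((u - v : A.domain) : H) := by
      rw [AddSubgroupClass.coe_sub]
      rw [neg_sub, sub_eq_sub_iff_add_eq_add, add_comm, huv, add_comm]
    rw [f4, inner_neg_left, inner_self_eq_norm_sq_to_K, inner_self_eq_norm_sq_to_K] at f3
    have f5 : -(‖((u - v : A.domain) : H)‖ ^ 2) = ‖A (u - v)‖ ^ 2 := by exact_mod_cast f3
    have f6 : ‖((u - v : A.domain) : H)‖ ^ 2 = 0 := by
      nlinarith [sq_nonneg ‖((u - v : A.domain) : H)‖, sq_nonneg ‖A (u - v)‖]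
    have f7 : ((u - v : A.domain) : H) = 0 := by simpa using f6
    rw [AddSubgroupClass.coe_sub] at f7
    exact sub_eq_zero.1 f7
  exact key ⟨S x, h1⟩ ⟨R x, h2⟩ h1' h2' (e1.trans e2.symm)

open Classical in
/-- `(1 + A* A)⁻¹` for a closed densely defined operator `A`. -/
noncomputable def invOneAddAdjMul (A : H →ₗ.[ℂ] H) : H →L[ℂ] H :=
  if h : ∃ R : H →L[ℂ] H, IsInvOneAddAdjMul A R then h.choose else 0

/-- The spectral projection `E_{(a,∞)}(B)` of a bounded self-adjoint operator `B`: the range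
projection of `(B - a)₊`. -/
noncomputable def spectralProjIoi (B : H →L[ℂ] H) (a : ℝ) : H →L[ℂ] H :=
  haveI : CompleteSpace (cfc (fun x : ℝ => max (x - a) 0) B).range.topologicalClosure :=
    (Submodule.isClosed_topologicalClosure _).completeSpace_coe
  (cfc (fun x : ℝ => max (x - a) 0) B).range.topologicalClosure.starProjection

/-- The spectral projection `E_{(l,∞)}(|A|)`, `l ≥ 0`, of the modulus `|A| = (A* A)^{1/2}` of a
closed densely defined operator `A`. With `φ x = x² / (1 + x²)`, which is strictly increasing on
`[0,∞)`, one has `φ(|A|) = 1 - (1 + A* A)⁻¹`, a bounded self-adjoint operator, and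
`E_{(l,∞)}(|A|) = E_{(φ l,∞)}(φ(|A|))`. -/
noncomputable def modulusSpectralProjIoi (A : H →ₗ.[ℂ] H) (l : ℝ≥0) : H →L[ℂ] H :=
  spectralProjIoi (1 - invOneAddAdjMul A) ((l : ℝ) ^ 2 / (1 + (l : ℝ) ^ 2))

/-- The positive square root `T^{1/2}` of a bounded positive operator `T`. -/
noncomputable def opSqrt (T : H →L[ℂ] H) : H →L[ℂ] H := CFC.sqrt T

/-- The generalised singular numbers `μ_t(A) = inf {l ≥ 0 : τ (E_{(l,∞)}(|A|)) ≤ t}`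
(with `inf ∅ = ∞`). -/
noncomputable def singularNumber (τ : (H →L[ℂ] H) → ℝ≥0∞) (A : H →ₗ.[ℂ] H) (t : ℝ) : ℝ≥0∞ :=
  ⨅ (l : ℝ≥0) (_ : τ (modulusSpectralProjIoi A l) ≤ ENNReal.ofReal t), (l : ℝ≥0∞)

/-- The noncommutative weak Lorentz (quasi)norm
`‖A‖_{L^{r,∞}} = sup_{t > 0} t^{1/r} μ_t(A)`, with values in `[0,∞]`. -/
noncomputable def weakLorentzNorm (τ : (H →L[ℂ] H) → ℝ≥0∞) (r : ℝ) (A : H →ₗ.[ℂ] H) : ℝ≥0∞ :=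
  ⨆ (t : ℝ) (_ : 0 < t), ENNReal.ofReal (t ^ (1 / r)) * singularNumber τ A t

end OperatorTheory

section CompactGroup

variable {G : Type*} [Group G] [TopologicalSpace G] [IsTopologicalGroup G] [CompactSpace G]
  [MeasurableSpace G] [BorelSpace G] (μ : Measure G) [μ.IsHaarMeasure] [IsProbabilityMeasure μ]

/-- The normalised Haar measure of a compact group is invariant under right translations. -/
theorem measurePreserving_mul_right_of_compact (g : G) :
    MeasurePreserving (fun x : G => x * g) μ μ := by
  have hm : Measurable (fun x : G => x * g) := (continuous_mul_const g).measurable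
  have : IsProbabilityMeasure (μ.map (fun x : G => x * g)) :=
    Measure.isProbabilityMeasure_map hm.aemeasurable
  exact ⟨hm, Measure.isHaarMeasure_eq_of_isProbabilityMeasure _ μ⟩

/-- The right regular representation `π_R(g) f (x) = f (x g)` on `L²(G)`. -/
noncomputable def rightRegular (g : G) : Lp ℂ 2 μ →L[ℂ] Lp ℂ 2 μ :=
  (Lp.compMeasurePreservingₗᵢ ℂ (fun x : G => x * g)
    (measurePreserving_mul_right_of_compact μ g)).toContinuousLinearMap

/-- The right group von Neumann algebra `VN_R(G)`: the von Neumann algebra on `L²(G)` generated by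
the right regular representation. -/
noncomputable def rightGroupVNA : VonNeumannAlgebra (Lp ℂ 2 μ) :=
  generatedVNA (Set.range (rightRegular μ))

/-- The canonical (Plancherel) trace on the positive part of `VN_R(G)`: `τ(T) = ‖f‖²` if `T^{1/2}`
is the operator `h ↦ h * f` of convolution with a (then unique) `f ∈ L²(G)`, and `τ(T) = ∞` if
there is no such `f`. -/
noncomputable def plancherelTrace (T : Lp ℂ 2 μ →L[ℂ] Lp ℂ 2 μ) : ℝ≥0∞ :=
  ⨅ (f : Lp ℂ 2 μ) (_ : ∀ h : Lp ℂ 2 μ,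
      (opSqrt T h : G → ℂ) =ᵐ[μ] fun x => ∫ y, h y * f (y⁻¹ * x) ∂μ),
    ENNReal.ofReal (‖f‖ ^ 2)

/-- A left Fourier multiplier on `G`: an operator on `L²(G)` that is affiliated with `VN_R(G)` and
`τ`-measurable for the canonical trace. -/
def IsLeftFourierMultiplier (A : Lp ℂ 2 μ →ₗ.[ℂ] Lp ℂ 2 μ) : Prop :=
  IsTauMeasurable (rightGroupVNA μ) (plancherelTrace μ) A

end CompactGroup

/-- A continuous irreducible unitary representation of `G` on `ℂ^dim`. (All continuous irreducible
unitary representations of a compact group are finite dimensional, hence of this form up to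
unitary equivalence.) -/
structure IrredUnitaryRep (G : Type*) [Group G] [TopologicalSpace G] where
  dim : ℕ
  toHom : G →* Matrix.unitaryGroup (Fin dim) ℂ
  continuous_toHom : Continuous toHom
  dim_pos : 0 < dim
  irreducible : ∀ W : Submodule ℂ (Fin dim → ℂ),
    (∀ g : G, ∀ v ∈ W, Matrix.mulVec (toHom g : Matrix (Fin dim) (Fin dim) ℂ) v ∈ W) →
      W = ⊥ ∨ W = ⊤

section Dual

variable {G : Type*} [Group G] [TopologicalSpace G]

/-- The matrix `ξ(g)`. -/
def IrredUnitaryRep.mat (ξ : IrredUnitaryRep G) (g : G) : Matrix (Fin ξ.dim) (Fin ξ.dim) ℂ :=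
  ξ.toHom g

/-- Unitary equivalence of irreducible unitary representations. -/
def IrredUnitaryRep.Equivalent (ξ η : IrredUnitaryRep G) : Prop :=
  ∃ T : EuclideanSpace ℂ (Fin ξ.dim) ≃ₗᵢ[ℂ] EuclideanSpace ℂ (Fin η.dim),
    ∀ (g : G) (v : EuclideanSpace ℂ (Fin ξ.dim)),
      T (Matrix.toEuclideanCLM (𝕜 := ℂ) (ξ.mat g) v) =
        Matrix.toEuclideanCLM (𝕜 := ℂ) (η.mat g) (T v)

variable (G) in
/-- Unitary equivalence as a setoid. -/
def IrredUnitaryRep.setoid : Setoid (IrredUnitaryRep G) where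
  r := IrredUnitaryRep.Equivalent
  iseqv :=
    { refl := fun ξ => ⟨LinearIsometryEquiv.refl ℂ _, fun g v => rfl⟩
      symm := by
        rintro ξ η ⟨T, hT⟩
        refine ⟨T.symm, fun g v => ?_⟩
        apply T.injective
        rw [hT]
        simp
      trans := by
        rintro ξ η ζ ⟨T, hT⟩ ⟨S, hS⟩
        refine ⟨T.trans S, fun g v => ?_⟩
        simp [hT, hS] }

variable (G) in
/-- The unitary dual `Ĝ` of the compact group `G`. -/
def UnitaryDual : Type _ := Quotient (IrredUnitaryRep.setoid G)

/-- A chosen representative of a class in `Ĝ`. -/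
noncomputable def UnitaryDual.rep (c : UnitaryDual G) : IrredUnitaryRep G := Quotient.out c

theorem IrredUnitaryRep.continuous_mat_apply (ξ : IrredUnitaryRep G) (i j : Fin ξ.dim) :
    Continuous fun g => ξ.mat g i j :=
  (continuous_subtype_val.comp ξ.continuous_toHom).matrix_elem i j

variable [CompactSpace G] [MeasurableSpace G] [BorelSpace G] (μ : Measure G) [IsFiniteMeasure μ]

/-- The matrix coefficient `g ↦ ξ(g)_{ij}` as an element of `L²(G)`. -/
noncomputable def IrredUnitaryRep.coeff (ξ : IrredUnitaryRep G) (i j : Fin ξ.dim) : Lp ℂ 2 μ :=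
  ContinuousMap.toLp 2 μ ℂ ⟨fun g => ξ.mat g i j, ξ.continuous_mat_apply i j⟩

variable {μ}

open Classical in
/-- The value at the identity `e` of (the continuous representative of) `f ∈ L²(G)`. -/
noncomputable def evalAtOne (f : Lp ℂ 2 μ) : ℂ :=
  if h : ∃ φ : C(G, ℂ), ContinuousMap.toLp 2 μ ℂ φ = f then h.choose 1 else 0

open Classical in
/-- `A f` for `f` in the domain of `A`, and `0` otherwise. -/
noncomputable def applyOrZero (A : Lp ℂ 2 μ →ₗ.[ℂ] Lp ℂ 2 μ) (f : Lp ℂ 2 μ) : Lp ℂ 2 μ :=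
  if h : f ∈ A.domain then A ⟨f, h⟩ else 0

/-- The global symbol `σ_A(ξ) = ξ(g)* (A ξ)(g)` at `g = e`, where `A` acts on the matrix valued
function `ξ` entrywise. -/
noncomputable def globalSymbol (A : Lp ℂ 2 μ →ₗ.[ℂ] Lp ℂ 2 μ) (ξ : IrredUnitaryRep G) :
    Matrix (Fin ξ.dim) (Fin ξ.dim) ℂ :=
  (ξ.mat 1).conjTranspose * Matrix.of fun i j => evalAtOne (applyOrZero A (ξ.coeff μ i j))

/-- The global symbol of `A` at `ξ` is meaningful: each matrix coefficient of `ξ` lies in the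
domain of `A`, and is mapped by `A` to (the class of) a continuous function. -/
def HasGlobalSymbol (A : Lp ℂ 2 μ →ₗ.[ℂ] Lp ℂ 2 μ) (ξ : IrredUnitaryRep G) : Prop :=
  ∀ i j, ∃ (h : ξ.coeff μ i j ∈ A.domain) (φ : C(G, ℂ)),
    A ⟨ξ.coeff μ i j, h⟩ = ContinuousMap.toLp 2 μ ℂ φ

/-- The operator norm `‖σ_A(ξ)‖` on `ℂ^{d_ξ}` with its Hilbert space norm; it does not depend on
the representative of the class of `ξ`. -/
noncomputable def symbolNorm (A : Lp ℂ 2 μ →ₗ.[ℂ] Lp ℂ 2 μ) (c : UnitaryDual G) : ℝ :=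
  ‖Matrix.toEuclideanCLM (𝕜 := ℂ) (globalSymbol A c.rep)‖

/-- `sup_{s > 0} s (∑_{ξ ∈ Ĝ, ‖σ_A(ξ)‖ ≥ s} d_ξ²)^a`, with values in `[0,∞]`. -/
noncomputable def symbolBound (A : Lp ℂ 2 μ →ₗ.[ℂ] Lp ℂ 2 μ) (a : ℝ) : ℝ≥0∞ :=
  ⨆ (s : ℝ) (_ : 0 < s), ENNReal.ofReal s *
    (∑' c : {c : UnitaryDual G // s ≤ symbolNorm A c}, (c.1.rep.dim : ℝ≥0∞) ^ 2) ^ a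

end Dual

/-! The operator is block diagonal over the unitary dual, and the trace of a spectral projection is
bounded block by block.

Everything commuting with right translations lies in the commutant of `rightGroupVNA`: in particular
left translations, and the orthogonal projection onto the span of the matrix coefficients of any ξ.
Compatibility with the projections makes A preserve each of these finite dimensional blocks
(`IsAffiliated.mem_domain_of_starProjection_mem`); compatibility with left translations forces Aξ =
ξσ_A(ξ) (`IsAffiliated.apply_coeff`). Hence A has norm at most ‖σ_A(ξ)‖ on the block of ξ
(`IsAffiliated.norm_apply_le`).

If ‖σ_A(ξ)‖ < l, then E_{(l,∞)}(|A|) kills the block of ξ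
(`IsInvOneAddAdjMul.spectralProjIoi_apply_eq_zero`). By Peter–Weyl
(`eq_zero_of_mem_orthogonal_coeffSpace`) the blocks are total. If only finitely many have ‖σ_A(ξ)‖ ≥
l, the projection E is convolution with EK, where K is the sum of d_ξ times the character of ξ over
them, so τ(E) ≤ ‖EK‖² ≤ ‖K‖² = ∑ d_ξ² (`plancherelTrace_le`).

Let a = 1/p - 1/q and let M be the right-hand side, assumed finite. If s > 0 and s t^a ≥ M, the sum
of d_ξ² over ‖σ_A(ξ)‖ ≥ s is at most t, whence μ_t(A) ≤ s. Letting s decrease to M/t^a gives the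
inequality. The projections 1 - E_{(s,∞)}(|A|) for large s give τ-measurability. -/

set_option linter.unusedSectionVars false

open scoped Matrix

/-! ### Affiliated operators, (1 + A*A)⁻¹ and spectral projections -/

section OperatorTheory

variable {H : Type*} [NormedAddCommGroup H] [InnerProductSpace ℂ H] [CompleteSpace H]

theorem mem_commutant_generatedVNA {s : Set (H →L[ℂ] H)} {U : H →L[ℂ] H}
    (h : ∀ a ∈ s, Commute a U) (h' : ∀ a ∈ s, Commute (star a) U) :
    U ∈ (generatedVNA s).commutant := by
  rw [VonNeumannAlgebra.mem_commutant_iff]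
  intro T hT
  have hT' : T ∈ Set.centralizer (StarSubalgebra.centralizer ℂ s : Set (H →L[ℂ] H)) := by
    have : T ∈ StarSubalgebra.centralizer ℂ
      (StarSubalgebra.centralizer ℂ s : Set (H →L[ℂ] H)) := hT
    rw [StarSubalgebra.mem_centralizer_iff] at this
    exact fun x hx => (this x hx).1
  refine (hT' U ?_).symm
  rw [SetLike.mem_coe, StarSubalgebra.mem_centralizer_iff]
  exact fun g hg => ⟨h g hg, h' g hg⟩

theorem isInvOneAddAdjMul_invOneAddAdjMul {A : H →ₗ.[ℂ] H} (hc : A.IsClosed)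
    (hd : Dense (A.domain : Set H)) : IsInvOneAddAdjMul A (invOneAddAdjMul A) := by
  have h : ∃ R : H →L[ℂ] H, IsInvOneAddAdjMul A R := (existsUnique_isInvOneAddAdjMul A hc hd).exists
  rw [invOneAddAdjMul, dif_pos h]
  exact h.choose_spec

theorem IsInvOneAddAdjMul.inner_eq {A : H →ₗ.[ℂ] H} {R : H →L[ℂ] H}
    (hd : Dense (A.domain : Set H)) (hR : IsInvOneAddAdjMul A R) (x : H) (w : A.domain) :
    inner ℂ x (w : H) = inner ℂ (R x) (w : H) + inner ℂ (A ⟨R x, (hR x).choose⟩) (A w) := by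
  obtain ⟨h, h', e⟩ := hR x
  conv_lhs => rw [← e]
  rw [inner_add_left]
  congr 1
  exact LinearPMap.adjoint_isFormalAdjoint hd ⟨A ⟨R x, h⟩, h'⟩ w

theorem IsInvOneAddAdjMul.isSelfAdjoint {A : H →ₗ.[ℂ] H} {R : H →L[ℂ] H}
    (hd : Dense (A.domain : Set H)) (hR : IsInvOneAddAdjMul A R) : IsSelfAdjoint R := by
  rw [ContinuousLinearMap.isSelfAdjoint_iff_isSymmetric]
  intro x y
  have h1 := hR.inner_eq hd x ⟨R y, (hR y).choose⟩
  have h2 := hR.inner_eq hd y ⟨R x, (hR x).choose⟩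
  have h3 := congrArg (starRingEnd ℂ) h2
  rw [map_add, inner_conj_symm, inner_conj_symm, inner_conj_symm] at h3
  change inner ℂ (R x) y = inner ℂ x (R y)
  rw [h1, h3]

/-- A lower bound for R = (1 + A*A)⁻¹ that needs no functional calculus of |A|. With u = Rw, pairing
(1 + A*A)u = w with w and with u gives ‖w‖² ≤ (‖u‖ + l‖Au‖)‖w‖ and Re⟨Rw, w⟩ = ‖u‖² + ‖Au‖²;
Cauchy–Schwarz in the plane finishes. -/
theorem IsInvOneAddAdjMul.norm_sq_le {A : H →ₗ.[ℂ] H} {R : H →L[ℂ] H}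
    (hd : Dense (A.domain : Set H)) (hR : IsInvOneAddAdjMul A R) {l : ℝ} (w : A.domain)
    (hw : ‖A w‖ ≤ l * ‖(w : H)‖) :
    ‖(w : H)‖ ^ 2 ≤ (1 + l ^ 2) * (inner ℂ (R w) (w : H)).re := by
  set u : A.domain := ⟨R w, (hR w).choose⟩ with hu
  have h1 := hR.inner_eq hd w w
  have h2 := hR.inner_eq hd w u
  have e1 : ‖(w : H)‖ ^ 2 = (inner ℂ (R w) (w : H)).re + (inner ℂ (A u) (A w)).re := by
    have := congrArg Complex.re h1
    rw [Complex.add_re] at this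
    rw [← this]
    exact (inner_self_eq_norm_sq (𝕜 := ℂ) (w : H)).symm
  have e2 : (inner ℂ (R w) (w : H)).re = ‖(u : H)‖ ^ 2 + ‖A u‖ ^ 2 := by
    have := congrArg Complex.re h2
    rw [Complex.add_re] at this
    have a1 : (inner ℂ (R w) (u : H)).re = ‖(u : H)‖ ^ 2 := inner_self_eq_norm_sq (𝕜 := ℂ) (u : H)
    have a2 : (inner ℂ (A u) (A u)).re = ‖A u‖ ^ 2 := inner_self_eq_norm_sq (𝕜 := ℂ) (A u)
    rw [← hu, a1, a2] at this
    rw [← this]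
    exact inner_re_symm (𝕜 := ℂ) _ _
  have c1 : (inner ℂ (R w) (w : H)).re ≤ ‖(u : H)‖ * ‖(w : H)‖ :=
    (Complex.re_le_norm _).trans (norm_inner_le_norm _ _)
  have c2 : (inner ℂ (A u) (A w)).re ≤ ‖A u‖ * ‖A w‖ :=
    (Complex.re_le_norm _).trans (norm_inner_le_norm _ _)
  have c3 : ‖A u‖ * ‖A w‖ ≤ ‖A u‖ * (l * ‖(w : H)‖) := by gcongr
  rw [e2]
  have c4 : ‖(w : H)‖ ^ 2 ≤ (‖(u : H)‖ + l * ‖A u‖) * ‖(w : H)‖ := by linarith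
  rcases (norm_nonneg (w : H)).eq_or_lt with h0 | h0
  · rw [← h0, zero_pow two_ne_zero]; positivity
  have c5 : ‖(w : H)‖ ≤ ‖(u : H)‖ + l * ‖A u‖ := by
    rw [sq] at c4; exact le_of_mul_le_mul_right c4 h0
  calc ‖(w : H)‖ ^ 2 ≤ (‖(u : H)‖ + l * ‖A u‖) ^ 2 := by gcongr
    _ ≤ (1 + l ^ 2) * (‖(u : H)‖ ^ 2 + ‖A u‖ ^ 2) := by
      nlinarith [sq_nonneg (l * ‖(u : H)‖ - ‖A u‖)]

theorem IsAffiliated.adjoint_apply {M : VonNeumannAlgebra H} {A : H →ₗ.[ℂ] H}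
    (hA : IsAffiliated M A) {U : H →L[ℂ] H} (hU : U ∈ M.commutant) (hu : U ∈ unitary (H →L[ℂ] H))
    (y : A.adjoint.domain) :
    ∃ h : U y ∈ A.adjoint.domain, A.adjoint ⟨U y, h⟩ = U (A.adjoint y) := by
  have key : ∀ x : A.domain, inner ℂ (U (A.adjoint y)) (x : H) = inner ℂ (U y) (A x) := by
    intro x
    obtain ⟨h, e⟩ := hA.2.2 (star U) (star_mem hU) (Unitary.star_mem hu) x
    have f := LinearPMap.adjoint_isFormalAdjoint hA.2.1 y ⟨star U x, h⟩
    rw [e] at f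
    have g1 : inner ℂ (U (A.adjoint y)) (x : H) = inner ℂ (A.adjoint y) (star U (x : H)) :=
      (ContinuousLinearMap.adjoint_inner_right U _ _).symm
    have g2 : inner ℂ (U y) (A x) = inner ℂ (y : H) (star U (A x)) :=
      (ContinuousLinearMap.adjoint_inner_right U _ _).symm
    rw [g1, g2]
    exact f
  refine ⟨LinearPMap.mem_adjoint_domain_of_exists _ ⟨_, key⟩, ?_⟩
  exact LinearPMap.adjoint_apply_eq hA.2.1 _ key

/-- The conjugate URU* solves the same defining equation as R, so uniqueness gives URU* = R. -/
theorem IsAffiliated.commute_invOneAddAdjMul_of_unitary {M : VonNeumannAlgebra H} {A : H →ₗ.[ℂ] H}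
    (hA : IsAffiliated M A) {U : H →L[ℂ] H} (hU : U ∈ M.commutant)
    (hu : U ∈ unitary (H →L[ℂ] H)) : Commute (invOneAddAdjMul A) U := by
  set R := invOneAddAdjMul A
  have hR : IsInvOneAddAdjMul A R := isInvOneAddAdjMul_invOneAddAdjMul hA.1 hA.2.1
  have hR' : IsInvOneAddAdjMul A (U * R * star U) := by
    intro x
    obtain ⟨h, h', e⟩ := hR (star U x)
    obtain ⟨k, ek⟩ := hA.2.2 U hU hu ⟨_, h⟩
    obtain ⟨k', ek'⟩ := hA.adjoint_apply hU hu ⟨_, h'⟩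
    simp only at ek ek' k k'
    have hk' : A ⟨U (R (star U x)), k⟩ ∈ A.adjoint.domain := by rw [ek]; exact k'
    refine ⟨k, hk', ?_⟩
    have : A.adjoint ⟨A ⟨U (R (star U x)), k⟩, hk'⟩ = U (A.adjoint ⟨A ⟨R (star U x), h⟩, h'⟩) := by
      rw [← ek']; congr 2
    refine (congrArg (U (R (star U x)) + ·) this).trans ?_
    rw [← map_add, e]
    exact DFunLike.congr_fun (Unitary.mul_star_self_of_mem hu) x
  have := (existsUnique_isInvOneAddAdjMul A hA.1 hA.2.1).unique hR hR'
  calc R * U = U * R * star U * U := by rw [← this]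
    _ = U * R := by rw [mul_assoc, Unitary.star_mul_self_of_mem hu, mul_one]

theorem VonNeumannAlgebra.isClosed_coe (M : VonNeumannAlgebra H) :
    IsClosed (M : Set (H →L[ℂ] H)) := by
  rw [← M.centralizer_centralizer]
  exact Set.isClosed_centralizer _

/-- Affiliation tests only unitaries of the commutant. Since M is a C*-algebra, four unitaries of M
span any given element, which extends commutation relations to the whole commutant. -/
theorem VonNeumannAlgebra.mem_span_unitary {M : VonNeumannAlgebra H} {T : H →L[ℂ] H} (hT : T ∈ M) :
    T ∈ Submodule.span ℂ {U : H →L[ℂ] H | U ∈ M ∧ U ∈ unitary (H →L[ℂ] H)} := by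
  have : IsClosed (M.toStarSubalgebra : Set (H →L[ℂ] H)) := M.isClosed_coe
  obtain ⟨u, c, hu, -⟩ :=
    CStarAlgebra.exists_sum_four_unitary (⟨T, hT⟩ : M.toStarSubalgebra)
  have e : T = ∑ i, c i • ((u i : M.toStarSubalgebra) : H →L[ℂ] H) := by
    have := congrArg (fun z : M.toStarSubalgebra => (z : H →L[ℂ] H)) hu
    simpa using this
  rw [e]
  refine Submodule.sum_mem _ fun i _ => Submodule.smul_mem _ _ (Submodule.subset_span ⟨?_, ?_⟩)
  · exact (u i : M.toStarSubalgebra).2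
  · have := (u i).2
    rw [Unitary.mem_iff] at this ⊢
    exact ⟨congrArg Subtype.val this.1, congrArg Subtype.val this.2⟩

theorem IsAffiliated.commute_invOneAddAdjMul {M : VonNeumannAlgebra H} {A : H →ₗ.[ℂ] H}
    (hA : IsAffiliated M A) {T : H →L[ℂ] H} (hT : T ∈ M.commutant) :
    Commute (invOneAddAdjMul A) T := by
  have h := VonNeumannAlgebra.mem_span_unitary hT
  clear hT
  induction h using Submodule.span_induction with
  | mem U hU => exact hA.commute_invOneAddAdjMul_of_unitary hU.1 hU.2
  | zero => exact Commute.zero_right _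
  | add x y _ _ hx hy => exact hx.add_right hy
  | smul c x _ hx => exact hx.smul_right c

theorem isStarProjection_spectralProjIoi (B : H →L[ℂ] H) (a : ℝ) :
    IsStarProjection (spectralProjIoi B a) := by
  unfold spectralProjIoi
  exact isStarProjection_starProjection

/-- The operator (B - a)₊ is self-adjoint, so its kernel is the orthogonal complement of its range.
-/
theorem spectralProjIoi_apply_eq_zero_iff (B : H →L[ℂ] H) (a : ℝ) (v : H) :
    spectralProjIoi B a v = 0 ↔ cfc (fun x : ℝ => max (x - a) 0) B v = 0 := by
  have : CompleteSpace (cfc (fun x : ℝ => max (x - a) 0) B).range.topologicalClosure :=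
    (Submodule.isClosed_topologicalClosure _).completeSpace_coe
  have h1 : spectralProjIoi B a v = 0 ↔
      v ∈ ((cfc (fun x : ℝ => max (x - a) 0) B).range.topologicalClosure)ᗮ := by
    unfold spectralProjIoi
    exact Submodule.starProjection_apply_eq_zero_iff _
  have hs : IsSelfAdjoint (cfc (fun x : ℝ => max (x - a) 0) B) := cfc_predicate _ _
  rw [h1, Submodule.orthogonal_closure, ContinuousLinearMap.orthogonal_range,
    ← ContinuousLinearMap.star_eq_adjoint, hs.star_eq]
  rfl

/-- An operator T of the commutant preserves the kernel of (B - a)₊, so ET = ETE. The same for T*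
gives TE = ETE. -/
theorem spectralProjIoi_mem {M : VonNeumannAlgebra H} {B : H →L[ℂ] H}
    (hB : ∀ T ∈ M.commutant, Commute B T) (a : ℝ) : spectralProjIoi B a ∈ M := by
  have hE := isStarProjection_spectralProjIoi B a
  rw [← M.commutant_commutant, VonNeumannAlgebra.mem_commutant_iff]
  have key : ∀ T ∈ M.commutant,
      spectralProjIoi B a * T = spectralProjIoi B a * T * spectralProjIoi B a := by
    intro T hT
    ext v
    set w := v - spectralProjIoi B a v with hw
    have h0 : spectralProjIoi B a w = 0 := by
      have := DFunLike.congr_fun hE.isIdempotentElem.eq v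
      rw [hw, map_sub, sub_eq_zero]
      exact this.symm
    rw [spectralProjIoi_apply_eq_zero_iff] at h0
    have h1 : spectralProjIoi B a (T w) = 0 := by
      rw [spectralProjIoi_apply_eq_zero_iff]
      have := DFunLike.congr_fun ((hB T hT).cfc_real (fun x : ℝ => max (x - a) 0)).eq w
      refine this.trans ?_
      change T (cfc (fun x : ℝ => max (x - a) 0) B w) = 0
      rw [h0, map_zero]
    rw [hw, map_sub, map_sub, sub_eq_zero] at h1
    exact h1
  intro T hT
  have h1 := key T hT
  have h2 := congrArg star (key (star T) (star_mem hT))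
  simp only [star_mul, star_star, hE.isSelfAdjoint.star_eq] at h2
  rw [h1, h2, mul_assoc]

/-- Let B = 1 - R, C = (B - a)₊ and S = C^{1/2}. Then C² = S(B - a)S, and w = SPv = PSv is again in
the range of P, where A is bounded by l. So ‖CPv‖² = ⟨w, (B - a)w⟩ = (1 - a)‖w‖² - Re⟨Rw, w⟩, which
is at most 0 because 1 - a = 1/(1 + l²). -/
theorem IsInvOneAddAdjMul.spectralProjIoi_apply_eq_zero {A : H →ₗ.[ℂ] H} {R : H →L[ℂ] H}
    (hd : Dense (A.domain : Set H)) (hR : IsInvOneAddAdjMul A R) {P : H →L[ℂ] H}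
    (hP : Commute R P) {l : ℝ}
    (hl : ∀ v : H, ∃ h : P v ∈ A.domain, ‖A ⟨P v, h⟩‖ ≤ l * ‖P v‖) (v : H) :
    spectralProjIoi (1 - R) (l ^ 2 / (1 + l ^ 2)) (P v) = 0 := by
  set a := l ^ 2 / (1 + l ^ 2) with ha
  set B := 1 - R with hB
  have hBs : IsSelfAdjoint B := (IsSelfAdjoint.one _).sub (hR.isSelfAdjoint hd)
  rw [spectralProjIoi_apply_eq_zero_iff]
  set C := cfc (fun x : ℝ => max (x - a) 0) B with hC
  set S := cfc (fun x : ℝ => √(max (x - a) 0)) B with hS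
  have hSs : IsSelfAdjoint S := cfc_predicate _ _
  have hSP : Commute S P := (((Commute.one_left P).sub_left hP)).cfc_real _
  have hCs : IsSelfAdjoint C := cfc_predicate _ _
  have e1 : C * C = S * (B - algebraMap ℝ _ a) * S := by
    have : B - algebraMap ℝ (H →L[ℂ] H) a = cfc (fun x : ℝ => x - a) B := by
      rw [cfc_sub _ _ B, cfc_id' ℝ B, cfc_const a B]
    rw [this, hC, hS, ← cfc_mul _ _ B, ← cfc_mul _ _ B, ← cfc_mul _ _ B]
    congr 1
    ext x
    rcases le_total (x - a) 0 with h | h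
    · rw [max_eq_right h]; simp
    · rw [max_eq_left h, mul_right_comm, Real.mul_self_sqrt h]
  obtain ⟨w, hw⟩ : ∃ w, w = S (P v) := ⟨_, rfl⟩
  have hwP : w = P (S v) := hw.trans (DFunLike.congr_fun hSP.eq v)
  obtain ⟨hwd, hwn⟩ := hl (S v)
  simp only [← hwP] at hwn
  have hn := hR.norm_sq_le hd ⟨w, hwP ▸ hwd⟩ (l := l) hwn
  simp only at hn
  have e2 : inner ℂ (C (P v)) (C (P v)) = inner ℂ w ((B - algebraMap ℝ _ a) w) := by
    have h1 : inner ℂ (C (P v)) (C (P v)) = inner ℂ (P v) ((C * C) (P v)) :=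
      (ContinuousLinearMap.isSelfAdjoint_iff_isSymmetric.1 hCs) (P v) (C (P v))
    have h2 : inner ℂ w ((B - algebraMap ℝ _ a) w) = inner ℂ (P v) (S ((B - algebraMap ℝ _ a) w)) := by
      conv_lhs => rw [hw]
      rw [hw]
      exact (ContinuousLinearMap.isSelfAdjoint_iff_isSymmetric.1 hSs) (P v) _
    rw [h1, h2, e1, hw]
    rfl
  have e3 : ‖C (P v)‖ ^ 2 = (1 - a) * ‖w‖ ^ 2 - (inner ℂ (R w) w).re := by
    have h1 : ‖C (P v)‖ ^ 2 = (inner ℂ (C (P v)) (C (P v))).re :=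
      (inner_self_eq_norm_sq (𝕜 := ℂ) _).symm
    have h2 : (B - algebraMap ℝ (H →L[ℂ] H) a) w = (((1 - a : ℝ) : ℂ)) • w - R w := by
      have : (algebraMap ℝ (H →L[ℂ] H) a) w = (a : ℂ) • w := rfl
      rw [sub_apply, this, hB]
      simp only [sub_apply, one_apply_eq_self]
      push_cast
      module
    have h3 : (inner ℂ w w).re = ‖w‖ ^ 2 := inner_self_eq_norm_sq (𝕜 := ℂ) _
    have h4 : (inner ℂ w (R w)).re = (inner ℂ (R w) w).re := inner_re_symm (𝕜 := ℂ) _ _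
    rw [h1, e2, h2, inner_sub_right, inner_smul_right, Complex.sub_re, Complex.re_ofReal_mul, h3, h4]
  have ha1 : 1 - a = (1 + l ^ 2)⁻¹ := by
    rw [ha]; field_simp; ring
  have hpos : 0 < 1 + l ^ 2 := by positivity
  have e4 : (1 - a) * ‖w‖ ^ 2 ≤ (inner ℂ (R w) w).re := by
    rw [ha1, inv_mul_le_iff₀ hpos]; exact hn
  have e5 : ‖C (P v)‖ ^ 2 ≤ 0 := by rw [e3]; linarith
  simpa using e5

/-- On the kernel of the spectral projection R has a bounded inverse given by functional calculus,
so v lies in the range of R and thus in the domain of A. -/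
theorem IsInvOneAddAdjMul.mem_domain_of_spectralProjIoi_apply_eq_zero {A : H →ₗ.[ℂ] H}
    {R : H →L[ℂ] H} (hd : Dense (A.domain : Set H)) (hR : IsInvOneAddAdjMul A R) {a : ℝ}
    (ha : a < 1) {v : H} (hv : spectralProjIoi (1 - R) a v = 0) : v ∈ A.domain := by
  set b := 1 - a with hb
  have hb0 : 0 < b := by rw [hb]; linarith
  have hRs : IsSelfAdjoint R := hR.isSelfAdjoint hd
  have hBs : IsSelfAdjoint (1 - R) := (IsSelfAdjoint.one _).sub hRs
  rw [spectralProjIoi_apply_eq_zero_iff] at hv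
  have e0 : R = cfc (fun x : ℝ => 1 - x) (1 - R) := by
    rw [cfc_sub _ _ (1 - R), cfc_id' ℝ (1 - R), cfc_const 1 (1 - R)]
    simp
  -- With b = 1 - a this is the scalar identity 1 = (1 - x)/max(1 - x, b) + (x - a)₊/b applied to 1
  -- - R.
  have e1 : (1 : H →L[ℂ] H) = R * cfc (fun x : ℝ => (max (1 - x) b)⁻¹) (1 - R) +
      b⁻¹ • cfc (fun x : ℝ => max (x - a) 0) (1 - R) := by
    have hcont : Continuous (fun x : ℝ => (max (1 - x) b)⁻¹) :=
      Continuous.inv₀ (by fun_prop) fun x => (lt_max_of_lt_right hb0).ne'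
    conv_rhs => enter [1, 1]; rw [e0]
    rw [← cfc_mul _ _ (1 - R) (by fun_prop) hcont.continuousOn, ← cfc_smul _ _ (1 - R),
      ← cfc_add (1 - R) _ _ (by fun_prop) (by fun_prop)]
    refine (cfc_const_one ℝ (1 - R)).symm.trans ?_
    congr 1
    ext x
    rcases le_total (x - a) 0 with h | h
    · rw [max_eq_right h, max_eq_left (by linarith : b ≤ 1 - x), smul_zero, add_zero,
        mul_inv_cancel₀ (by linarith)]
    · rw [max_eq_left h, max_eq_right (by linarith : 1 - x ≤ b), smul_eq_mul]
      field_simp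
      linarith
  have e2 := DFunLike.congr_fun e1 v
  simp only [one_apply_eq_self, add_apply, smul_apply, hv, smul_zero, add_zero] at e2
  rw [e2]
  exact (hR _).choose

theorem opSqrt_of_isStarProjection {E : H →L[ℂ] H} (hE : IsStarProjection E) : opSqrt E = E :=
  CFC.sqrt_unique hE.isIdempotentElem hE.nonneg

end OperatorTheory

/-! ### Translations on L²(G) and the commutant of the right group algebra -/

section Translations

variable {G : Type*} [Group G] [TopologicalSpace G] [IsTopologicalGroup G] [CompactSpace G]
  [MeasurableSpace G] [BorelSpace G] (μ : Measure G) [μ.IsHaarMeasure] [IsProbabilityMeasure μ]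

/-- The translation `f ↦ (x ↦ f (g x))` on `L²(G)`. -/
noncomputable def leftShift (g : G) : Lp ℂ 2 μ →L[ℂ] Lp ℂ 2 μ :=
  (Lp.compMeasurePreservingₗᵢ ℂ (fun x : G => g * x)
    (measurePreserving_mul_left μ g)).toContinuousLinearMap

/-- Right translation of a continuous function. -/
noncomputable def rightTranslate (g : G) (φ : C(G, ℂ)) : C(G, ℂ) := ⟨fun x => φ (x * g), by fun_prop⟩

/-- Left translation of a continuous function. -/
noncomputable def leftTranslate (g : G) (φ : C(G, ℂ)) : C(G, ℂ) := ⟨fun x => φ (g * x), by fun_prop⟩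

theorem rightRegular_toLp (g : G) (φ : C(G, ℂ)) :
    rightRegular μ g (ContinuousMap.toLp 2 μ ℂ φ) =
      ContinuousMap.toLp 2 μ ℂ (rightTranslate g φ) := rfl

theorem leftShift_toLp (g : G) (φ : C(G, ℂ)) :
    leftShift μ g (ContinuousMap.toLp 2 μ ℂ φ) =
      ContinuousMap.toLp 2 μ ℂ (leftTranslate g φ) := rfl

theorem rightRegular_mul_apply (g h : G) (u : Lp ℂ 2 μ) :
    rightRegular μ (g * h) u = rightRegular μ g (rightRegular μ h u) := by
  have := Lp.compMeasurePreserving_comp_apply (p := 2) u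
    (measurePreserving_mul_right_of_compact μ h) (measurePreserving_mul_right_of_compact μ g)
  refine Eq.trans ?_ this
  change Lp.compMeasurePreserving _ _ u = _
  congr 1
  congr 1
  ext x
  simp [mul_assoc]

theorem rightRegular_one_apply (u : Lp ℂ 2 μ) : rightRegular μ 1 u = u := by
  refine Eq.trans ?_ (Lp.compMeasurePreserving_id_apply (p := 2) u)
  change Lp.compMeasurePreserving _ _ u = _
  congr 1
  congr 1
  ext x
  simp

theorem leftShift_mul_apply (g h : G) (u : Lp ℂ 2 μ) :
    leftShift μ (g * h) u = leftShift μ h (leftShift μ g u) := by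
  have := Lp.compMeasurePreserving_comp_apply (p := 2) u
    (measurePreserving_mul_left μ g) (measurePreserving_mul_left μ h)
  refine Eq.trans ?_ this
  change Lp.compMeasurePreserving _ _ u = _
  congr 1
  congr 1
  ext x
  simp [mul_assoc]

theorem leftShift_one_apply (u : Lp ℂ 2 μ) : leftShift μ 1 u = u := by
  refine Eq.trans ?_ (Lp.compMeasurePreserving_id_apply (p := 2) u)
  change Lp.compMeasurePreserving _ _ u = _
  congr 1
  congr 1
  ext x
  simp

theorem leftShift_rightRegular (g h : G) (u : Lp ℂ 2 μ) :
    leftShift μ g (rightRegular μ h u) = rightRegular μ h (leftShift μ g u) := by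
  have h1 := Lp.compMeasurePreserving_comp_apply (p := 2) u
    (measurePreserving_mul_right_of_compact μ h) (measurePreserving_mul_left μ g)
  have h2 := Lp.compMeasurePreserving_comp_apply (p := 2) u
    (measurePreserving_mul_left μ g) (measurePreserving_mul_right_of_compact μ h)
  refine h1.symm.trans (Eq.trans ?_ h2)
  congr 1
  congr 1
  ext x
  simp [mul_assoc]

theorem inner_rightRegular_right (g : G) (u v : Lp ℂ 2 μ) :
    inner ℂ u (rightRegular μ g v) = inner ℂ (rightRegular μ g⁻¹ u) v := by
  have h := LinearIsometry.inner_map_map (Lp.compMeasurePreservingₗᵢ ℂ (fun x : G => x * g)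
    (measurePreserving_mul_right_of_compact μ g)) (rightRegular μ g⁻¹ u) v
  rw [← h]
  congr 1
  change u = rightRegular μ g (rightRegular μ g⁻¹ u)
  rw [← rightRegular_mul_apply, mul_inv_cancel, rightRegular_one_apply]

theorem inner_leftShift_right (g : G) (u v : Lp ℂ 2 μ) :
    inner ℂ u (leftShift μ g v) = inner ℂ (leftShift μ g⁻¹ u) v := by
  have h := LinearIsometry.inner_map_map (Lp.compMeasurePreservingₗᵢ ℂ (fun x : G => g * x)
    (measurePreserving_mul_left μ g)) (leftShift μ g⁻¹ u) v
  rw [← h]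
  congr 1
  change u = leftShift μ g (leftShift μ g⁻¹ u)
  rw [← leftShift_mul_apply, inv_mul_cancel, leftShift_one_apply]

theorem star_rightRegular (g : G) : star (rightRegular μ g) = rightRegular μ g⁻¹ := by
  rw [ContinuousLinearMap.star_eq_adjoint, eq_comm, ContinuousLinearMap.eq_adjoint_iff]
  exact fun x y => (inner_rightRegular_right μ g x y).symm

theorem star_leftShift (g : G) : star (leftShift μ g) = leftShift μ g⁻¹ := by
  rw [ContinuousLinearMap.star_eq_adjoint, eq_comm, ContinuousLinearMap.eq_adjoint_iff]
  exact fun x y => (inner_leftShift_right μ g x y).symm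

theorem leftShift_mem_unitary (g : G) : leftShift μ g ∈ unitary (Lp ℂ 2 μ →L[ℂ] Lp ℂ 2 μ) := by
  rw [Unitary.mem_iff, star_leftShift]
  constructor <;> ext1 u <;> change leftShift μ _ (leftShift μ _ u) = u <;>
    simp [← leftShift_mul_apply, leftShift_one_apply]

theorem mem_commutant_rightGroupVNA {U : Lp ℂ 2 μ →L[ℂ] Lp ℂ 2 μ}
    (h : ∀ g u, U (rightRegular μ g u) = rightRegular μ g (U u)) :
    U ∈ (rightGroupVNA μ).commutant := by
  refine mem_commutant_generatedVNA ?_ ?_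
  · rintro _ ⟨g, rfl⟩
    ext1 u
    exact (h g u).symm
  · rintro _ ⟨g, rfl⟩
    rw [star_rightRegular]
    ext1 u
    exact (h _ u).symm

theorem leftShift_mem_commutant (g : G) : leftShift μ g ∈ (rightGroupVNA μ).commutant :=
  mem_commutant_rightGroupVNA μ fun _ _ => leftShift_rightRegular μ _ _ _

/-- Strong continuity makes the matrix representations cut out of L²(G) continuous. -/
theorem continuous_rightRegular_apply [T2Space G] [SecondCountableTopology G] (u : Lp ℂ 2 μ) :
    Continuous fun g => rightRegular μ g u := by
  have hc : Continuous fun g : G => (⟨fun x => x * g, by fun_prop⟩ : C(G, G)) := by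
    refine ContinuousMap.continuous_of_continuous_uncurry _ ?_
    exact continuous_snd.mul continuous_fst
  exact Continuous.compMeasurePreservingLp continuous_const hc
    (measurePreserving_mul_right_of_compact μ) (by simp)

/-- A subspace invariant under right translations. -/
def IsRightInvariant (V : Submodule ℂ (Lp ℂ 2 μ)) : Prop :=
  ∀ g, ∀ v ∈ V, rightRegular μ g v ∈ V

variable {μ}

theorem IsRightInvariant.orthogonal {V : Submodule ℂ (Lp ℂ 2 μ)} (hV : IsRightInvariant μ V) :
    IsRightInvariant μ Vᗮ := by
  intro g v hv
  rw [Submodule.mem_orthogonal] at hv ⊢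
  intro u hu
  rw [inner_rightRegular_right]
  exact hv _ (hV _ _ hu)

theorem IsRightInvariant.inf {V W : Submodule ℂ (Lp ℂ 2 μ)} (hV : IsRightInvariant μ V)
    (hW : IsRightInvariant μ W) : IsRightInvariant μ (V ⊓ W) :=
  fun g v hv => ⟨hV g v hv.1, hW g v hv.2⟩

theorem IsRightInvariant.starProjection_mem_commutant {V : Submodule ℂ (Lp ℂ 2 μ)}
    [V.HasOrthogonalProjection] (hV : IsRightInvariant μ V) :
    V.starProjection ∈ (rightGroupVNA μ).commutant := by
  refine mem_commutant_rightGroupVNA μ fun g u => ?_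
  refine (Submodule.eq_starProjection_of_mem_orthogonal (hV g _ (V.starProjection_apply_mem u)) ?_)
  rw [← map_sub]
  exact hV.orthogonal g _ (V.sub_starProjection_mem_orthogonal u)

end Translations

/-! ### Compactness of operators with continuous kernel -/

section KernelOperator

variable {X : Type*} [TopologicalSpace X] [CompactSpace X]
  {H : Type*} [NormedAddCommGroup H] [InnerProductSpace ℂ H]

/-- The operator `f ↦ (x ↦ ⟪Φ x, f⟫)` from a Hilbert space to continuous functions. -/
noncomputable def kernelOperator (Φ : C(X, H)) : H →L[ℂ] C(X, ℂ) :=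
  LinearMap.mkContinuous
    { toFun := fun f => ⟨fun x => inner ℂ (Φ x) f, by fun_prop⟩
      map_add' := fun f g => by ext x; simp
      map_smul' := fun c f => by ext x; simp } ‖Φ‖ (by
    intro f
    rw [ContinuousMap.norm_le _ (by positivity)]
    intro x
    refine (norm_inner_le_norm _ _).trans ?_
    gcongr
    exact Φ.norm_coe_le_norm x)

@[simp]
theorem kernelOperator_apply (Φ : C(X, H)) (f : H) (x : X) :
    kernelOperator Φ f x = inner ℂ (Φ x) f := rfl

/-- Arzelà–Ascoli: by Cauchy–Schwarz the image of the unit ball is bounded by ‖Φ‖ and inherits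
equicontinuity from Φ. -/
theorem isCompactOperator_kernelOperator (Φ : C(X, H)) : IsCompactOperator (kernelOperator Φ) := by
  let e := ContinuousMap.linearIsometryBoundedOfCompact X ℂ ℂ
  let S := (e : C(X, ℂ) →L[ℂ] BoundedContinuousFunction X ℂ) ∘L kernelOperator Φ
  have hS : IsCompactOperator S := by
    refine (isCompactOperator_iff_isCompact_closure_image_closedBall
      (S : H →ₗ[ℂ] BoundedContinuousFunction X ℂ) one_pos).2 ?_
    refine BoundedContinuousFunction.arzela_ascoli (Metric.closedBall 0 ‖Φ‖)
      (isCompact_closedBall _ _) _ ?_ ?_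
    · rintro _ x ⟨f, hf, rfl⟩
      rw [mem_closedBall_zero_iff] at hf ⊢
      change ‖inner ℂ (Φ x) f‖ ≤ _
      refine (norm_inner_le_norm _ _).trans ?_
      exact (mul_le_of_le_one_right (norm_nonneg _) hf).trans (Φ.norm_coe_le_norm x)
    · intro x
      rw [Metric.equicontinuousAt_iff_right]
      intro ε hε
      have h1 : ∀ᶠ y in nhds x, dist (Φ x) (Φ y) < ε := by
        have := (Φ.continuous.tendsto x).eventually (Metric.ball_mem_nhds (Φ x) hε)
        filter_upwards [this] with y hy
        rwa [dist_comm]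
      filter_upwards [h1] with y hy
      rintro ⟨_, f, hf, rfl⟩
      rw [mem_closedBall_zero_iff] at hf
      change dist (inner ℂ (Φ x) f) (inner ℂ (Φ y) f) < ε
      rw [dist_eq_norm, ← inner_sub_left]
      refine (norm_inner_le_norm _ _).trans_lt ?_
      refine (mul_le_of_le_one_right (norm_nonneg _) hf).trans_lt ?_
      rwa [← dist_eq_norm]
  have := hS.continuous_comp e.symm.continuous
  have e1 : (kernelOperator Φ : H → C(X, ℂ)) = e.symm ∘ S := by
    funext f
    exact (e.symm_apply_apply _).symm
  rwa [e1]

end KernelOperator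

/-! ### Convolution operators -/

section PeterWeyl

variable {G : Type*} [Group G] [TopologicalSpace G] [IsTopologicalGroup G] [CompactSpace G]
  [T2Space G] [SecondCountableTopology G]
  [MeasurableSpace G] [BorelSpace G] (μ : Measure G) [μ.IsHaarMeasure] [IsProbabilityMeasure μ]

/-- The kernel `x ↦ (y ↦ k (x y⁻¹))`. -/
noncomputable def convolutionKernel (k : C(G, ℂ)) : C(G, C(G, ℂ)) :=
  ContinuousMap.curry ⟨fun p => k (p.1 * p.2⁻¹), by fun_prop⟩

/-- The convolution kernel with values in `L²(G)`. -/
noncomputable def convolutionKernelLp (k : C(G, ℂ)) : C(G, Lp ℂ 2 μ) :=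
  ⟨fun x => ContinuousMap.toLp 2 μ ℂ (convolutionKernel k x), by fun_prop⟩

/-- Convolution with `k̄` on the left, as an operator on `L²(G)`. -/
noncomputable def convolutionOperator (k : C(G, ℂ)) : Lp ℂ 2 μ →L[ℂ] Lp ℂ 2 μ :=
  ContinuousMap.toLp 2 μ ℂ ∘L kernelOperator (convolutionKernelLp μ k)

theorem isCompactOperator_convolutionOperator (k : C(G, ℂ)) :
    IsCompactOperator (convolutionOperator μ k) :=
  IsCompactOperator.continuous_comp (f := kernelOperator (convolutionKernelLp μ k))
    (g := (ContinuousMap.toLp 2 μ ℂ : C(G, ℂ) →L[ℂ] Lp ℂ 2 μ))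
    (isCompactOperator_kernelOperator _) (ContinuousLinearMap.continuous _)

theorem rightRegular_convolutionKernelLp (k : C(G, ℂ)) (g x : G) :
    rightRegular μ g⁻¹ (convolutionKernelLp μ k x) = convolutionKernelLp μ k (x * g) := by
  refine (rightRegular_toLp μ _ _).trans ?_
  refine congrArg (ContinuousMap.toLp 2 μ ℂ) ?_
  ext y
  change k (x * (y * g⁻¹)⁻¹) = k (x * g * y⁻¹)
  simp [mul_assoc]

/-- The kernel depends on (x, y) only through xy⁻¹, which is unchanged under (x, y) ↦ (xg, yg). -/
theorem convolutionOperator_rightRegular (k : C(G, ℂ)) (g : G) (u : Lp ℂ 2 μ) :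
    convolutionOperator μ k (rightRegular μ g u) = rightRegular μ g (convolutionOperator μ k u) := by
  refine Eq.trans ?_ (rightRegular_toLp μ _ _).symm
  refine congrArg (ContinuousMap.toLp 2 μ ℂ) ?_
  ext x
  change inner ℂ _ (rightRegular μ g u) = inner ℂ (convolutionKernelLp μ k (x * g)) u
  rw [inner_rightRegular_right, rightRegular_convolutionKernelLp]

theorem adjoint_convolutionOperator_rightRegular (k : C(G, ℂ)) (g : G) (u : Lp ℂ 2 μ) :
    (convolutionOperator μ k).adjoint (rightRegular μ g u) =
      rightRegular μ g ((convolutionOperator μ k).adjoint u) := by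
  refine ext_inner_left ℂ fun v => ?_
  rw [ContinuousLinearMap.adjoint_inner_right, inner_rightRegular_right, inner_rightRegular_right,
    ContinuousLinearMap.adjoint_inner_right, convolutionOperator_rightRegular]

/-- The adjoint sends v to a superposition of the continuous kernel functions with weights v(x), and
this Bochner integral already converges in C(G). -/
theorem adjoint_convolutionOperator_mem_range (k : C(G, ℂ)) (v : Lp ℂ 2 μ) :
    ∃ φ : C(G, ℂ), (convolutionOperator μ k).adjoint v = ContinuousMap.toLp 2 μ ℂ φ := by
  have hv : Integrable v μ := (Lp.memLp v).integrable (by norm_num)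
  have hint : Integrable (fun x => v x • convolutionKernel k x) μ := by
    refine Integrable.mono' (g := fun x => ‖v x‖ * ‖convolutionKernel k‖) (hv.norm.mul_const _) ?_ ?_
    · exact hv.aestronglyMeasurable.smul (convolutionKernel k).continuous.aestronglyMeasurable
    · filter_upwards with x
      rw [norm_smul]
      gcongr
      exact (convolutionKernel k).norm_coe_le_norm x
  refine ⟨∫ x, v x • convolutionKernel k x ∂μ, ?_⟩
  rw [← ContinuousLinearMap.integral_comp_comm _ hint]
  refine ext_inner_left ℂ fun u => ?_
  have hint' := (ContinuousMap.toLp 2 μ ℂ : C(G, ℂ) →L[ℂ] Lp ℂ 2 μ).integrable_comp hint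
  rw [ContinuousLinearMap.adjoint_inner_right, ← integral_inner hint' u, L2.inner_def]
  refine integral_congr_ae ?_
  filter_upwards [ContinuousMap.coeFn_toLp (p := 2) (𝕜 := ℂ) μ
    (kernelOperator (convolutionKernelLp μ k) u)] with x hx
  have : (convolutionOperator μ k u) x = inner ℂ (convolutionKernelLp μ k x) u := hx
  rw [this, map_smul, inner_smul_right, RCLike.inner_apply, inner_conj_symm]
  rfl

end PeterWeyl

/-! ### Matrix coefficients and the blocks they span -/

namespace IrredUnitaryRep

section Mat

variable {G : Type*} [Group G] [TopologicalSpace G] (ξ η : IrredUnitaryRep G)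

theorem mat_mul (g h : G) : ξ.mat (g * h) = ξ.mat g * ξ.mat h := by
  simp [mat]

theorem mat_one : ξ.mat 1 = 1 := by
  simp [mat]

theorem mat_inv (g : G) : ξ.mat g⁻¹ = (ξ.mat g).conjTranspose := by
  simp only [mat, map_inv]
  rfl

theorem mat_inv_apply (g : G) (i j : Fin ξ.dim) : ξ.mat g⁻¹ i j = star (ξ.mat g j i) := by
  rw [mat_inv]; rfl

end Mat

section CoefficientSpace

variable {G : Type*} [Group G] [TopologicalSpace G] [CompactSpace G]
  [MeasurableSpace G] [BorelSpace G] (μ : Measure G)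

/-- The matrix coefficient as a continuous function. -/
noncomputable def matCoeff (ξ : IrredUnitaryRep G) (i j : Fin ξ.dim) : C(G, ℂ) :=
  ⟨fun g => ξ.mat g i j, ξ.continuous_mat_apply i j⟩

theorem coeff_eq [IsFiniteMeasure μ] (ξ : IrredUnitaryRep G) (i j : Fin ξ.dim) :
    ξ.coeff μ i j = ContinuousMap.toLp 2 μ ℂ (ξ.matCoeff i j) := rfl

/-- The span in `L²(G)` of the matrix coefficients of `ξ`. -/
noncomputable def coeffSpace [IsFiniteMeasure μ] (ξ : IrredUnitaryRep G) :
    Submodule ℂ (Lp ℂ 2 μ) :=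
  Submodule.span ℂ (Set.range fun ij : Fin ξ.dim × Fin ξ.dim => ξ.coeff μ ij.1 ij.2)

instance [IsFiniteMeasure μ] (ξ : IrredUnitaryRep G) : FiniteDimensional ℂ (ξ.coeffSpace μ) :=
  FiniteDimensional.span_of_finite ℂ (Set.finite_range _)

theorem coeff_mem_coeffSpace [IsFiniteMeasure μ] (ξ : IrredUnitaryRep G) (i j : Fin ξ.dim) :
    ξ.coeff μ i j ∈ ξ.coeffSpace μ :=
  Submodule.subset_span ⟨(i, j), rfl⟩

theorem exists_continuous_of_mem_coeffSpace [IsFiniteMeasure μ] (ξ : IrredUnitaryRep G)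
    {v : Lp ℂ 2 μ} (hv : v ∈ ξ.coeffSpace μ) :
    ∃ φ : C(G, ℂ), v = ContinuousMap.toLp 2 μ ℂ φ := by
  have : ξ.coeffSpace μ ≤
      LinearMap.range (ContinuousMap.toLp 2 μ ℂ : C(G, ℂ) →L[ℂ] Lp ℂ 2 μ).toLinearMap := by
    refine Submodule.span_le.2 ?_
    rintro _ ⟨ij, rfl⟩
    exact ⟨ξ.matCoeff ij.1 ij.2, rfl⟩
  obtain ⟨φ, hφ⟩ := this hv
  exact ⟨φ, hφ.symm⟩

variable [IsTopologicalGroup G] [μ.IsHaarMeasure] [IsProbabilityMeasure μ]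

theorem rightRegular_coeff (ξ : IrredUnitaryRep G) (g : G) (i j : Fin ξ.dim) :
    rightRegular μ g (ξ.coeff μ i j) = ∑ k, ξ.mat g k j • ξ.coeff μ i k := by
  simp only [coeff_eq, rightRegular_toLp, ← map_smul, ← map_sum]
  congr 1
  ext x
  change ξ.mat (x * g) i j = _
  rw [mat_mul, Matrix.mul_apply, ContinuousMap.sum_apply]
  exact Finset.sum_congr rfl fun k _ => mul_comm _ _

theorem leftShift_coeff (ξ : IrredUnitaryRep G) (g : G) (i j : Fin ξ.dim) :
    leftShift μ g (ξ.coeff μ i j) = ∑ k, ξ.mat g i k • ξ.coeff μ k j := by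
  simp only [coeff_eq, leftShift_toLp, ← map_smul, ← map_sum]
  congr 1
  ext x
  change ξ.mat (g * x) i j = _
  rw [mat_mul, Matrix.mul_apply, ContinuousMap.sum_apply]
  rfl

theorem isRightInvariant_coeffSpace (ξ : IrredUnitaryRep G) :
    IsRightInvariant μ (ξ.coeffSpace μ) := by
  intro g v hv
  have : ξ.coeffSpace μ ≤ (ξ.coeffSpace μ).comap (rightRegular μ g).toLinearMap := by
    refine Submodule.span_le.2 ?_
    rintro _ ⟨ij, rfl⟩
    change rightRegular μ g (ξ.coeff μ _ _) ∈ ξ.coeffSpace μ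
    rw [rightRegular_coeff]
    exact Submodule.sum_mem _ fun k _ => Submodule.smul_mem _ _ (ξ.coeff_mem_coeffSpace μ _ _)
  exact this hv

/-- For a unitary equivalence T, ξ(g)_{ij} = ⟨Te_i, η(g)Te_j⟩, which expands in the coefficients of
η. -/
theorem Equivalent.coeff_mem_coeffSpace {ξ η : IrredUnitaryRep G} (h : ξ.Equivalent η)
    (i j : Fin ξ.dim) : ξ.coeff μ i j ∈ η.coeffSpace μ := by
  obtain ⟨T, hT⟩ := h
  let v := T (EuclideanSpace.single i 1)
  let w := T (EuclideanSpace.single j 1)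
  have key : ∀ g, ξ.mat g i j = ∑ k, ∑ l, (star (v k) * w l) * η.mat g k l := by
    intro g
    have h1 : ξ.mat g i j = inner ℂ (EuclideanSpace.single i (1 : ℂ))
        (Matrix.toEuclideanCLM (𝕜 := ℂ) (ξ.mat g) (EuclideanSpace.single j 1)) := by
      simp [EuclideanSpace.inner_single_left, Matrix.ofLp_toEuclideanCLM]
    rw [h1, ← T.inner_map_map, hT, PiLp.inner_apply]
    refine Finset.sum_congr rfl fun k _ => ?_
    rw [RCLike.inner_apply, Matrix.ofLp_toEuclideanCLM, Matrix.mulVec, dotProduct, Finset.sum_mul]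
    refine Finset.sum_congr rfl fun l _ => ?_
    change η.mat g k l * w l * star (v k) = _
    ring
  have h2 : ξ.matCoeff i j = ∑ k, ∑ l, (star (v k) * w l) • η.matCoeff k l := by
    ext g
    simp only [ContinuousMap.sum_apply, ContinuousMap.smul_apply]
    exact key g
  rw [coeff_eq, h2, map_sum]
  refine Submodule.sum_mem _ fun k _ => ?_
  rw [map_sum]
  refine Submodule.sum_mem _ fun l _ => ?_
  rw [map_smul]
  exact Submodule.smul_mem _ _ (η.coeff_mem_coeffSpace μ k l)

end CoefficientSpace

end IrredUnitaryRep

/-! ### The Peter–Weyl theorem: completeness of the matrix coefficients -/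

section PeterWeyl
variable {G : Type*} [Group G] [TopologicalSpace G] [IsTopologicalGroup G] [CompactSpace G]
  [T2Space G] [SecondCountableTopology G]
  [MeasurableSpace G] [BorelSpace G] (μ : Measure G) [μ.IsHaarMeasure] [IsProbabilityMeasure μ]

/-- The span of all matrix coefficients. -/
noncomputable def coeffSpan : Submodule ℂ (Lp ℂ 2 μ) :=
  ⨆ ξ : IrredUnitaryRep G, ξ.coeffSpace μ

/-- A finite dimensional irreducible subspace of continuous functions consists of matrix
coefficients. -/
theorem le_coeffSpan_of_irreducible (V : Submodule ℂ (Lp ℂ 2 μ)) [FiniteDimensional ℂ V]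
    (hV : IsRightInvariant μ V) (hV0 : V ≠ ⊥)
    (hc : ∀ v ∈ V, ∃ φ : C(G, ℂ), v = ContinuousMap.toLp 2 μ ℂ φ)
    (hirr : ∀ W ≤ V, IsRightInvariant μ W → W = ⊥ ∨ W = V) : V ≤ coeffSpan μ := by
  let b := stdOrthonormalBasis ℂ V
  let m : G → Matrix (Fin (Module.finrank ℂ V)) (Fin (Module.finrank ℂ V)) ℂ := fun g =>
    Matrix.of fun i j => inner ℂ (b i : Lp ℂ 2 μ) (rightRegular μ g (b j))
  have hexp : ∀ v ∈ V, v = ∑ i, inner ℂ (b i : Lp ℂ 2 μ) v • (b i : Lp ℂ 2 μ) := by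
    intro v hv
    have := congrArg Subtype.val (b.sum_repr' ⟨v, hv⟩)
    simpa using this.symm
  have hm1 : m 1 = 1 := by
    ext i j
    simp only [m, Matrix.of_apply, rightRegular_one_apply, Matrix.one_apply]
    exact orthonormal_iff_ite.1 b.orthonormal i j
  have hmm : ∀ g h, m (g * h) = m g * m h := by
    intro g h
    ext i j
    rw [Matrix.mul_apply]
    simp only [m, Matrix.of_apply, rightRegular_mul_apply]
    conv_lhs => rw [hexp _ (hV h _ (b j).2), map_sum, inner_sum]
    refine Finset.sum_congr rfl fun k _ => ?_
    rw [map_smul, inner_smul_right, mul_comm]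
  have hms : ∀ g, m g⁻¹ = (m g).conjTranspose := by
    intro g
    ext i j
    simp only [m, Matrix.of_apply, Matrix.conjTranspose_apply]
    rw [inner_rightRegular_right, inv_inv]
    exact (inner_conj_symm _ _).symm
  have hmem : ∀ g, m g ∈ Matrix.unitaryGroup (Fin (Module.finrank ℂ V)) ℂ := by
    intro g
    rw [Matrix.mem_unitaryGroup_iff, Matrix.star_eq_conjTranspose, ← hms, ← hmm, mul_inv_cancel, hm1]
  have hcont : Continuous m := by
    refine continuous_matrix fun i j => ?_
    exact continuous_const.inner (continuous_rightRegular_apply μ _)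
  let f : G →* Matrix.unitaryGroup (Fin (Module.finrank ℂ V)) ℂ :=
    { toFun := fun g => ⟨m g, hmem g⟩
      map_one' := Subtype.ext hm1
      map_mul' := fun g h => Subtype.ext (hmm g h) }
  -- The coordinates of the orthonormal basis intertwine the matrices m with right translation on V,
  -- so irreducibility passes from V to m.
  let L : (Fin (Module.finrank ℂ V) → ℂ) →ₗ[ℂ] Lp ℂ 2 μ :=
    ∑ i, (LinearMap.proj i).smulRight (b i : Lp ℂ 2 μ)
  have hL : ∀ v, L v = ∑ i, v i • (b i : Lp ℂ 2 μ) := fun v => by simp [L]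
  have hLV : ∀ v, L v ∈ V := fun v => by
    rw [hL]; exact Submodule.sum_mem _ fun i _ => Submodule.smul_mem _ _ (b i).2
  have hinner : ∀ i v, inner ℂ (b i : Lp ℂ 2 μ) (L v) = v i := by
    intro i v
    rw [hL, inner_sum]
    simp only [inner_smul_right]
    have h := fun j => orthonormal_iff_ite.1 b.orthonormal i j
    simp only [Submodule.coe_inner] at h
    simp [h]
  have hLg : ∀ g v, L (m g *ᵥ v) = rightRegular μ g (L v) := by
    intro g v
    rw [hexp _ (hV g _ (hLV v)), hL]
    refine Finset.sum_congr rfl fun i _ => ?_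
    congr 1
    rw [hL v, map_sum, inner_sum, Matrix.mulVec, dotProduct]
    refine Finset.sum_congr rfl fun j _ => ?_
    rw [map_smul, inner_smul_right, mul_comm]
    rfl
  have hLinj : Function.Injective L := fun v w hvw => by
    ext i; rw [← hinner i v, hvw, hinner]
  have hLsurj : ∀ v ∈ V, L (fun i => inner ℂ (b i : Lp ℂ 2 μ) v) = v := fun v hv => by
    rw [hL]; exact (hexp v hv).symm
  let ξ : IrredUnitaryRep G :=
    { dim := Module.finrank ℂ V
      toHom := f
      continuous_toHom := hcont.subtype_mk _
      dim_pos := Module.finrank_pos_iff.2 (Submodule.nontrivial_iff_ne_bot.2 hV0)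
      irreducible := by
        intro W hW
        have h1 : W.map L ≤ V := by rintro _ ⟨v, -, rfl⟩; exact hLV v
        have h2 : IsRightInvariant μ (W.map L) := by
          rintro g _ ⟨v, hv, rfl⟩
          exact ⟨_, hW g v hv, hLg g v⟩
        rcases hirr _ h1 h2 with h | h
        · left
          rw [eq_bot_iff]
          intro v hv
          have : L v ∈ W.map L := ⟨v, hv, rfl⟩
          rw [h, Submodule.mem_bot] at this
          exact (Submodule.mem_bot ℂ).2 (hLinj (this.trans (map_zero L).symm))
        · right
          rw [eq_top_iff]
          intro v _
          obtain ⟨w, hw, e⟩ : L v ∈ W.map L := by rw [h]; exact hLV v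
          rwa [← hLinj e] }
  have hbξ : ∀ j, (b j : Lp ℂ 2 μ) ∈ ξ.coeffSpace μ := by
    intro j
    choose φ hφ using fun i => hc (b i) (b i).2
    have h1 : ∀ g, rightTranslate g (φ j) = ∑ i, m g i j • φ i := by
      intro g
      refine ContinuousMap.toLp_injective (p := 2) (𝕜 := ℂ) μ ?_
      rw [← rightRegular_toLp, ← hφ, map_sum]
      simp only [map_smul, ← hφ]
      exact hexp _ (hV g _ (b j).2)
    -- Evaluating the right translate by g at the identity recovers φ_j(g).
    have h2 : φ j = ∑ i, φ i 1 • ξ.matCoeff i j := by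
      ext g
      have := congrArg (fun ψ : C(G, ℂ) => ψ 1) (h1 g)
      simp only [ContinuousMap.sum_apply] at this
      rw [ContinuousMap.sum_apply]
      have e : rightTranslate g (φ j) 1 = φ j g := congrArg (φ j) (one_mul g)
      rw [← e, this]
      exact Finset.sum_congr rfl fun i _ => mul_comm _ _
    rw [hφ j, h2, map_sum]
    refine Submodule.sum_mem _ fun i _ => ?_
    rw [map_smul]
    exact Submodule.smul_mem _ _ (ξ.coeff_mem_coeffSpace μ i j)
  intro v hv
  refine Submodule.mem_iSup_of_mem ξ ?_
  rw [hexp v hv]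
  exact Submodule.sum_mem _ fun i _ => Submodule.smul_mem _ _ (hbξ i)

/-- Induction on the dimension: a proper nonzero invariant W splits V into the smaller invariant
pieces W and Wᗮ ⊓ V. -/
theorem le_coeffSpan_of_finrank_eq (n : ℕ) (V : Submodule ℂ (Lp ℂ 2 μ)) [FiniteDimensional ℂ V]
    (hV : IsRightInvariant μ V) (hn : Module.finrank ℂ V = n)
    (hc : ∀ v ∈ V, ∃ φ : C(G, ℂ), v = ContinuousMap.toLp 2 μ ℂ φ) : V ≤ coeffSpan μ := by
  induction n using Nat.strong_induction_on generalizing V with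
  | _ n ih =>
    by_cases hV0 : V = ⊥
    · rw [hV0]; exact bot_le
    by_cases hirr : ∀ W ≤ V, IsRightInvariant μ W → W = ⊥ ∨ W = V
    · exact le_coeffSpan_of_irreducible μ V hV hV0 hc hirr
    push Not at hirr
    obtain ⟨W, hWV, hW, hW0, hWne⟩ := hirr
    have : FiniteDimensional ℂ W := Submodule.finiteDimensional_of_le hWV
    have h1 : W ≤ coeffSpan μ :=
      ih _ (hn ▸ Submodule.finrank_lt_finrank_of_lt (lt_of_le_of_ne hWV hWne)) W hW rfl
        fun v hv => hc v (hWV hv)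
    have hlt : Wᗮ ⊓ V < V := by
      refine lt_of_le_of_ne inf_le_right fun h => hW0 ?_
      rw [eq_bot_iff]
      intro w hw
      have : w ∈ Wᗮ ⊓ V := by rw [h]; exact hWV hw
      exact (Submodule.mem_bot ℂ).2
        (inner_self_eq_zero.1 ((Submodule.mem_orthogonal _ _).1 this.1 w hw))
    have : FiniteDimensional ℂ (Wᗮ ⊓ V : Submodule ℂ (Lp ℂ 2 μ)) :=
      Submodule.finiteDimensional_of_le hlt.le
    have h2 : Wᗮ ⊓ V ≤ coeffSpan μ :=
      ih _ (hn ▸ Submodule.finrank_lt_finrank_of_lt hlt) _ (hW.orthogonal.inf hV) rfl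
        fun v hv => hc v hv.2
    rw [← Submodule.sup_orthogonal_inf_of_hasOrthogonalProjection hWV]
    exact sup_le h1 h2

/-- For a convolution operator T, the compact self-adjoint T*T commutes with right translations. Its
eigenspaces for nonzero eigenvalues are finite dimensional, right invariant and made of continuous
functions, hence lie in the span of the coefficients. So v is orthogonal to them, which forces T*Tv
= 0 and Tv = 0; varying the kernel gives v = 0. -/
theorem eq_zero_of_mem_orthogonal_coeffSpace {v : Lp ℂ 2 μ}
    (hv : ∀ ξ : IrredUnitaryRep G, v ∈ (ξ.coeffSpace μ)ᗮ) : v = 0 := by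
  have hv' : v ∈ (coeffSpan μ)ᗮ := by
    rw [coeffSpan, ← Submodule.iInf_orthogonal, Submodule.mem_iInf]
    exact hv
  have key : ∀ k : C(G, ℂ), convolutionOperator μ k v = 0 := by
    intro k
    set T := convolutionOperator μ k
    set S := T.adjoint ∘L T with hS
    have hSc : IsCompactOperator S :=
      (isCompactOperator_convolutionOperator μ k).continuous_comp T.adjoint.continuous
    have hSs : S.IsSymmetric := fun x y => by
      change inner ℂ (T.adjoint (T x)) y = inner ℂ x (T.adjoint (T y))
      rw [ContinuousLinearMap.adjoint_inner_left, ContinuousLinearMap.adjoint_inner_right]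
    have hle : ∀ c : ℂ, c ≠ 0 → Module.End.eigenspace (S : Module.End ℂ (Lp ℂ 2 μ)) c ≤ coeffSpan μ := by
      intro c hc
      have := ContinuousLinearMap.finite_dimensional_eigenspace hSc c hc
      refine le_coeffSpan_of_finrank_eq μ _ _ ?_ rfl ?_
      · intro g w hw
        rw [Module.End.mem_eigenspace_iff] at hw ⊢
        change T.adjoint (T w) = c • w at hw
        change T.adjoint (T (rightRegular μ g w)) = c • rightRegular μ g w
        rw [convolutionOperator_rightRegular, adjoint_convolutionOperator_rightRegular, hw, map_smul]
      · intro w hw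
        rw [Module.End.mem_eigenspace_iff] at hw
        change T.adjoint (T w) = c • w at hw
        obtain ⟨φ, hφ⟩ := adjoint_convolutionOperator_mem_range μ k (T w)
        refine ⟨c⁻¹ • φ, ?_⟩
        rw [map_smul, ← hφ, hw, smul_smul, inv_mul_cancel₀ hc, one_smul]
    have hbot := ContinuousLinearMap.orthogonalComplement_iSup_eigenspaces_eq_bot hSc hSs
    set N := Module.End.eigenspace (S : Module.End ℂ (Lp ℂ 2 μ)) 0 with hN
    have hNc : IsClosed (N : Set (Lp ℂ 2 μ)) := by
      rw [hN, Module.End.eigenspace_zero]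
      exact S.isClosed_ker
    have : CompleteSpace N := hNc.completeSpace_coe
    -- The difference is orthogonal to every eigenspace, so the spectral theorem puts v in the
    -- kernel of S.
    have hmem : v - N.starProjection v ∈ (⨆ c, Module.End.eigenspace (S : Module.End ℂ (Lp ℂ 2 μ)) c)ᗮ := by
      rw [← Submodule.iInf_orthogonal, Submodule.mem_iInf]
      intro c
      by_cases hc : c = 0
      · rw [hc]; exact N.sub_starProjection_mem_orthogonal v
      refine Submodule.sub_mem _ (Submodule.orthogonal_le (hle c hc) hv') ?_
      rw [Submodule.mem_orthogonal]
      intro u hu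
      exact hSs.orthogonalFamily_eigenspaces hc ⟨u, hu⟩ ⟨_, N.starProjection_apply_mem v⟩
    rw [hbot, Submodule.mem_bot, sub_eq_zero] at hmem
    have h0 : S v = 0 := by
      have : v ∈ N := by rw [hmem]; exact N.starProjection_apply_mem v
      rw [hN, Module.End.mem_eigenspace_iff, zero_smul] at this
      exact this
    have h1 : inner ℂ (T v) (T v) = 0 := by
      rw [← ContinuousLinearMap.adjoint_inner_right]
      change inner ℂ v (S v) = 0
      rw [h0, inner_zero_right]
    exact inner_self_eq_zero.1 h1
  have hzero : ∀ φ : C(G, ℂ), inner ℂ (ContinuousMap.toLp 2 μ ℂ φ) v = 0 := by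
    intro φ
    -- With this k the convolution evaluated at the identity is the inner product of φ with v.
    let k : C(G, ℂ) := ⟨fun x => φ x⁻¹, by fun_prop⟩
    have h1 : kernelOperator (convolutionKernelLp μ k) v = 0 :=
      ContinuousMap.toLp_injective (p := 2) (𝕜 := ℂ) μ ((key k).trans (map_zero _).symm)
    have h2 := congrArg (fun ψ : C(G, ℂ) => ψ 1) h1
    simp only [kernelOperator_apply, ContinuousMap.zero_apply] at h2
    rw [← h2]
    congr 1
    refine congrArg (ContinuousMap.toLp 2 μ ℂ) ?_
    ext y
    change φ y = φ (1 * y⁻¹)⁻¹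
    simp
  have hd : DenseRange (ContinuousMap.toLp 2 μ ℂ : C(G, ℂ) →L[ℂ] Lp ℂ 2 μ) :=
    ContinuousMap.toLp_denseRange ℂ μ ℂ (by simp)
  refine hd.eq_zero_of_inner_right ℂ ?_
  exact hzero

end PeterWeyl

/-! ### Schur's lemma -/

theorem norm_sq_eq_dotProduct {n : Type*} [Fintype n] (v : EuclideanSpace ℂ n) :
    (‖v‖ ^ 2 : ℂ) = star v.ofLp ⬝ᵥ v.ofLp := by
  have h : ((‖v‖ ^ 2 : ℝ) : ℂ) = star v.ofLp ⬝ᵥ v.ofLp := by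
    rw [EuclideanSpace.norm_sq_eq, dotProduct, Complex.ofReal_sum]
    refine Finset.sum_congr rfl fun i _ => ?_
    rw [Complex.ofReal_pow]
    exact (Complex.conj_mul' _).symm
  rw [← h, Complex.ofReal_pow]

namespace IrredUnitaryRep

section Schur

variable {G : Type*} [Group G] [TopologicalSpace G] {ξ η : IrredUnitaryRep G}

/-- An eigenspace of T is invariant and nonzero, hence everything. -/
theorem eq_smul_one_of_intertwining {T : Matrix (Fin ξ.dim) (Fin ξ.dim) ℂ}
    (hT : ∀ g, ξ.mat g * T = T * ξ.mat g) : ∃ c : ℂ, T = c • 1 := by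
  have : Nonempty (Fin ξ.dim) := ⟨⟨0, ξ.dim_pos⟩⟩
  obtain ⟨c, hc⟩ := Module.End.exists_eigenvalue (T.mulVecLin : Module.End ℂ (Fin ξ.dim → ℂ))
  refine ⟨c, ?_⟩
  have hinv : ∀ g : G, ∀ v ∈ Module.End.eigenspace T.mulVecLin c,
      ξ.mat g *ᵥ v ∈ Module.End.eigenspace T.mulVecLin c := by
    intro g v hv
    rw [Module.End.mem_eigenspace_iff] at hv ⊢
    change T *ᵥ v = c • v at hv
    change T *ᵥ (ξ.mat g *ᵥ v) = c • (ξ.mat g *ᵥ v)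
    rw [Matrix.mulVec_mulVec, ← hT, ← Matrix.mulVec_mulVec, hv, Matrix.mulVec_smul]
  rcases ξ.irreducible (Module.End.eigenspace T.mulVecLin c) hinv with h | h
  · exact absurd h hc
  · refine Matrix.ext_of_mulVec_single fun i => ?_
    have : (Pi.single i 1 : Fin ξ.dim → ℂ) ∈ Module.End.eigenspace T.mulVecLin c := by
      rw [h]; trivial
    rw [Module.End.mem_eigenspace_iff] at this
    rw [Matrix.smul_mulVec, Matrix.one_mulVec]
    exact this

open scoped ComplexOrder in
-- Both T*T and TT* are self-intertwiners, hence nonzero scalars c and c'. The first makes T/√c an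
-- isometry, the second makes it surjective.
theorem equivalent_of_intertwining {T : Matrix (Fin η.dim) (Fin ξ.dim) ℂ} (hT0 : T ≠ 0)
    (hT : ∀ g, η.mat g * T = T * ξ.mat g) : ξ.Equivalent η := by
  have hT' : ∀ g, ξ.mat g * Tᴴ = Tᴴ * η.mat g := by
    intro g
    have := congrArg Matrix.conjTranspose (hT g⁻¹)
    rw [Matrix.conjTranspose_mul, Matrix.conjTranspose_mul, mat_inv, mat_inv,
      Matrix.conjTranspose_conjTranspose, Matrix.conjTranspose_conjTranspose] at this
    exact this.symm
  obtain ⟨c, hc⟩ := eq_smul_one_of_intertwining (ξ := ξ) (T := Tᴴ * T) fun g => by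
    rw [← Matrix.mul_assoc, hT', Matrix.mul_assoc, hT, Matrix.mul_assoc]
  obtain ⟨c', hc'⟩ := eq_smul_one_of_intertwining (ξ := η) (T := T * Tᴴ) fun g => by
    rw [← Matrix.mul_assoc, hT, Matrix.mul_assoc, hT', Matrix.mul_assoc]
  have hc0 : c ≠ 0 := by
    rintro rfl
    rw [zero_smul] at hc
    exact hT0 (Matrix.conjTranspose_mul_self_eq_zero.1 hc)
  have hc'0 : c' ≠ 0 := by
    rintro rfl
    rw [zero_smul] at hc'
    exact hT0 (Matrix.self_mul_conjTranspose_eq_zero.1 hc')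
  let S : EuclideanSpace ℂ (Fin ξ.dim) →ₗ[ℂ] EuclideanSpace ℂ (Fin η.dim) := Matrix.toEuclideanLin T
  have hSapp : ∀ v, S v = WithLp.toLp 2 (T *ᵥ v.ofLp) := fun v => rfl
  have hS : ∀ v, (‖S v‖ ^ 2 : ℂ) = c * ‖v‖ ^ 2 := by
    intro v
    rw [norm_sq_eq_dotProduct, norm_sq_eq_dotProduct, hSapp]
    simp only [Matrix.star_mulVec]
    rw [← Matrix.dotProduct_mulVec, Matrix.mulVec_mulVec, hc, Matrix.smul_mulVec,
      Matrix.one_mulVec, dotProduct_smul, smul_eq_mul]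
  have hcr : (c.re : ℂ) = c ∧ 0 < c.re := by
    let v : EuclideanSpace ℂ (Fin ξ.dim) := EuclideanSpace.single ⟨0, ξ.dim_pos⟩ 1
    have h := hS v
    have hv : ‖v‖ = 1 := by simp [v]
    rw [hv] at h
    have h1 : c = ((‖S v‖ ^ 2 : ℝ) : ℂ) := by push_cast; rw [h]; simp
    have h2 : c.re = ‖S v‖ ^ 2 := by rw [h1, Complex.ofReal_re]
    refine ⟨by rw [h2, ← h1], lt_of_le_of_ne (by rw [h2]; positivity) ?_⟩
    intro h0
    apply hc0
    rw [h1, ← h2, ← h0, Complex.ofReal_zero]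
  set r := √c.re with hr
  have hr0 : 0 < r := Real.sqrt_pos.2 hcr.2
  let U : EuclideanSpace ℂ (Fin ξ.dim) →ₗᵢ[ℂ] EuclideanSpace ℂ (Fin η.dim) :=
    { toLinearMap := (r : ℂ)⁻¹ • S
      norm_map' := by
        intro v
        have h : ‖S v‖ ^ 2 = c.re * ‖v‖ ^ 2 := by
          have := hS v
          rw [← hcr.1] at this
          exact_mod_cast this
        rw [LinearMap.smul_apply, norm_smul, norm_inv, Complex.norm_of_nonneg hr0.le]
        rw [inv_mul_eq_iff_eq_mul₀ hr0.ne', ← sq_eq_sq₀ (norm_nonneg _) (by positivity), h, mul_pow,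
          hr, Real.sq_sqrt hcr.2.le] }
  have hUapp : ∀ v, U v = (r : ℂ)⁻¹ • S v := fun v => rfl
  have hsurj : Function.Surjective U := by
    intro w
    refine ⟨WithLp.toLp 2 (((r : ℂ) * c'⁻¹) • (Tᴴ *ᵥ w.ofLp)), ?_⟩
    rw [hUapp, hSapp]
    simp only [Matrix.mulVec_smul, Matrix.mulVec_mulVec, hc', Matrix.smul_mulVec, Matrix.one_mulVec,
      WithLp.toLp_smul, smul_smul]
    simp [hc'0, hr0.ne']
  refine ⟨LinearIsometryEquiv.ofSurjective U hsurj, fun g v => ?_⟩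
  rw [LinearIsometryEquiv.coe_ofSurjective, hUapp, hUapp, map_smul]
  congr 1
  rw [hSapp, hSapp]
  apply WithLp.ofLp_injective
  rw [Matrix.ofLp_toEuclideanCLM, Matrix.ofLp_toEuclideanCLM]
  simp only [Matrix.mulVec_mulVec, hT]

end Schur

/-! ### Schur orthogonality relations -/

section Orthogonality

variable {G : Type*} [Group G] [TopologicalSpace G] [IsTopologicalGroup G] [CompactSpace G]
  [MeasurableSpace G] [BorelSpace G] (μ : Measure G) [μ.IsHaarMeasure] [IsProbabilityMeasure μ]

/-- Unitarity of left translation: for fixed columns the Gram matrix is an intertwiner, so Schur's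
lemma determines it up to a scalar. -/
theorem inner_coeff_intertwining (ξ η : IrredUnitaryRep G) (j : Fin ξ.dim) (l : Fin η.dim) (g : G) :
    η.mat g * Matrix.of (fun k i => inner ℂ (ξ.coeff μ i j) (η.coeff μ k l)) =
      Matrix.of (fun k i => inner ℂ (ξ.coeff μ i j) (η.coeff μ k l)) * ξ.mat g := by
  ext k i
  rw [Matrix.mul_apply, Matrix.mul_apply]
  have h := inner_leftShift_right μ g (ξ.coeff μ i j) (η.coeff μ k l)
  rw [leftShift_coeff, leftShift_coeff, inner_sum, sum_inner] at h
  simp only [inner_smul_left, inner_smul_right] at h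
  simp only [Matrix.of_apply]
  rw [h]
  refine Finset.sum_congr rfl fun a _ => ?_
  rw [mul_comm]
  congr 1
  rw [mat_inv_apply]
  exact star_star _

theorem inner_coeff_of_not_equivalent {ξ η : IrredUnitaryRep G} (h : ¬ ξ.Equivalent η)
    (i j : Fin ξ.dim) (k l : Fin η.dim) : inner ℂ (ξ.coeff μ i j) (η.coeff μ k l) = 0 := by
  by_contra h0
  refine h (equivalent_of_intertwining ?_ (inner_coeff_intertwining μ ξ η j l))
  intro h1
  exact h0 (congrFun (congrFun h1 k) i)

theorem inner_coeff (ξ : IrredUnitaryRep G) (i j k l : Fin ξ.dim) :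
    inner ℂ (ξ.coeff μ i j) (ξ.coeff μ k l) = if i = k ∧ j = l then (ξ.dim : ℂ)⁻¹ else 0 := by
  obtain ⟨c, hc⟩ := eq_smul_one_of_intertwining (inner_coeff_intertwining μ ξ ξ j l)
  -- Columns of a unitary matrix are orthonormal at every g; integrating gives the trace, which
  -- fixes the scalar c.
  have htr : ∑ a, inner ℂ (ξ.coeff μ a j) (ξ.coeff μ a l) = if j = l then 1 else 0 := by
    simp only [coeff_eq, ContinuousMap.inner_toLp]
    rw [← integral_finsetSum]
    · have : ∀ g, ∑ a, ξ.matCoeff a l g * (starRingEnd ℂ) (ξ.matCoeff a j g) =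
          if j = l then 1 else 0 := by
        intro g
        have h1 : (ξ.mat g)ᴴ * ξ.mat g = 1 := by
          rw [← mat_inv, ← mat_mul, inv_mul_cancel, mat_one]
        have h2 := congrFun (congrFun h1 j) l
        rw [Matrix.mul_apply, Matrix.one_apply] at h2
        rw [← h2]
        exact Finset.sum_congr rfl fun a _ => mul_comm _ _
      simp only [this]
      simp
    · intro a _
      refine Continuous.integrable_of_hasCompactSupport (by fun_prop) ?_
      exact HasCompactSupport.of_compactSpace _
  have hdiag : ∀ a, inner ℂ (ξ.coeff μ a j) (ξ.coeff μ a l) = c := by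
    intro a
    have := congrFun (congrFun hc a) a
    simpa using this
  simp only [hdiag, Finset.sum_const, Finset.card_univ, Fintype.card_fin, nsmul_eq_mul] at htr
  have hd : (ξ.dim : ℂ) ≠ 0 := by exact_mod_cast ξ.dim_pos.ne'
  have hcval : c = if j = l then (ξ.dim : ℂ)⁻¹ else 0 := by
    split_ifs at htr ⊢ with hjl
    · exact eq_inv_of_mul_eq_one_right htr
    · exact (mul_eq_zero.1 htr).resolve_left hd
  have := congrFun (congrFun hc k) i
  simp only [Matrix.of_apply, Matrix.smul_apply, Matrix.one_apply, smul_eq_mul] at this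
  rw [this, hcval]
  by_cases h1 : i = k <;> by_cases h2 : j = l <;> simp [h1, h2, Ne.symm]

theorem inner_eq_zero_of_mem_coeffSpace {ξ η : IrredUnitaryRep G} (h : ¬ ξ.Equivalent η)
    {u v : Lp ℂ 2 μ} (hu : u ∈ ξ.coeffSpace μ) (hv : v ∈ η.coeffSpace μ) : inner ℂ u v = 0 := by
  have h1 : ξ.coeffSpace μ ⟂ η.coeffSpace μ := by
    rw [coeffSpace, coeffSpace, Submodule.isOrtho_span]
    rintro _ ⟨a, rfl⟩ _ ⟨b, rfl⟩
    exact inner_coeff_of_not_equivalent μ h _ _ _ _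
  exact h1.inner_eq hu hv

theorem starProjection_coeffSpace_apply (ξ : IrredUnitaryRep G) (h : Lp ℂ 2 μ) :
    (ξ.coeffSpace μ).starProjection h =
      ∑ i, ∑ j, ((ξ.dim : ℂ) * inner ℂ (ξ.coeff μ i j) h) • ξ.coeff μ i j := by
  refine Submodule.eq_starProjection_of_mem_orthogonal (K := ξ.coeffSpace μ) ?_ ?_
  · exact Submodule.sum_mem _ fun i _ => Submodule.sum_mem _ fun j _ =>
      Submodule.smul_mem _ _ (ξ.coeff_mem_coeffSpace μ i j)
  · rw [coeffSpace, Submodule.mem_orthogonal]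
    intro u hu
    induction hu using Submodule.span_induction with
    | mem u hu =>
      obtain ⟨⟨k, l⟩, rfl⟩ := hu
      have hd : (ξ.dim : ℂ) ≠ 0 := by exact_mod_cast ξ.dim_pos.ne'
      simp only [inner_sub_right, inner_sum, inner_smul_right, inner_coeff]
      rw [Finset.sum_eq_single k, Finset.sum_eq_single l]
      · simp; field_simp; simp
      · intro b _ hb; simp [hb.symm]
      · simp
      · intro b _ hb; simp [hb.symm]
      · simp
    | zero => simp
    | add x y _ _ hx hy => rw [inner_add_left, hx, hy, add_zero]
    | smul c x _ hx => rw [inner_smul_left, hx, mul_zero]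

theorem norm_sum_coeff_sq (ξ : IrredUnitaryRep G) (a : Fin ξ.dim → Fin ξ.dim → ℂ) :
    ‖∑ i, ∑ j, a i j • ξ.coeff μ i j‖ ^ 2 = (ξ.dim : ℝ)⁻¹ * ∑ i, ∑ j, ‖a i j‖ ^ 2 := by
  have h : ((‖∑ i, ∑ j, a i j • ξ.coeff μ i j‖ ^ 2 : ℝ) : ℂ) =
      (((ξ.dim : ℝ)⁻¹ * ∑ i, ∑ j, ‖a i j‖ ^ 2 : ℝ) : ℂ) := by
    push_cast
    refine (inner_self_eq_norm_sq_to_K (𝕜 := ℂ) (∑ i, ∑ j, a i j • ξ.coeff μ i j)).symm.trans ?_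
    rw [sum_inner, Finset.mul_sum]
    refine Finset.sum_congr rfl fun i _ => ?_
    rw [sum_inner, Finset.mul_sum]
    refine Finset.sum_congr rfl fun j _ => ?_
    simp only [inner_smul_left, inner_sum, inner_smul_right, inner_coeff]
    rw [Finset.sum_eq_single i, Finset.sum_eq_single j]
    · have := Complex.conj_mul' (a i j)
      simp only [and_self, if_true]
      rw [← this]; ring
    · intro b _ hb; simp [hb.symm]
    · simp
    · intro b _ hb; simp [hb.symm]
    · simp
  exact_mod_cast h

end Orthogonality

end IrredUnitaryRep

/-! ### Affiliated operators on finite dimensional reducing subspaces -/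

section Reduction

variable {H : Type*} [NormedAddCommGroup H] [InnerProductSpace ℂ H] [CompleteSpace H]

theorem two_smul_starProjection_sub_one_mem_unitary (V : Submodule ℂ H)
    [V.HasOrthogonalProjection] :
    (2 : ℂ) • V.starProjection - 1 ∈ unitary (H →L[ℂ] H) := by
  have hP : IsStarProjection V.starProjection := isStarProjection_starProjection
  have hs : star ((2 : ℂ) • V.starProjection - 1) = (2 : ℂ) • V.starProjection - 1 := by
    rw [star_sub, star_smul, hP.isSelfAdjoint.star_eq, star_one]
    simp
  have hm : ((2 : ℂ) • V.starProjection - 1) * ((2 : ℂ) • V.starProjection - 1) = 1 := by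
    have := hP.isIdempotentElem.eq
    simp only [sub_mul, mul_sub, smul_mul_assoc, mul_smul_comm, this, mul_one, one_mul]
    module
  rw [Unitary.mem_iff, hs]
  exact ⟨hm, hm⟩

/-- Applying affiliation to the reflection 2P - 1 shows that P preserves the domain and commutes
with A there. The image of the dense domain under P is dense in V, and being finite dimensional it
is closed, so it is all of V. -/
theorem IsAffiliated.mem_domain_of_starProjection_mem {M : VonNeumannAlgebra H} {A : H →ₗ.[ℂ] H}
    (hA : IsAffiliated M A) (V : Submodule ℂ H) [FiniteDimensional ℂ V]
    (hV : V.starProjection ∈ M.commutant) {v : H} (hv : v ∈ V) :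
    ∃ h : v ∈ A.domain, A ⟨v, h⟩ ∈ V := by
  set P := V.starProjection
  have hU : (2 : ℂ) • P - 1 ∈ M.commutant :=
    sub_mem (M.commutant.toStarSubalgebra.smul_mem hV 2) (one_mem _)
  have key : ∀ x : A.domain, ∃ h : P x ∈ A.domain, A ⟨P x, h⟩ = P (A x) := by
    intro x
    obtain ⟨h, e⟩ := hA.2.2 _ hU (two_smul_starProjection_sub_one_mem_unitary V) x
    have e1 : P (x : H) = (2 : ℂ)⁻¹ • ((x : H) + ((2 : ℂ) • P - 1) (x : H)) := by
      simp only [sub_apply, smul_apply, one_apply_eq_self, add_sub_cancel]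
      rw [smul_smul, inv_mul_cancel₀ two_ne_zero, one_smul]
    let y : A.domain := (2 : ℂ)⁻¹ • (x + ⟨((2 : ℂ) • P - 1) (x : H), h⟩)
    have hy : (y : H) = P x := e1.symm
    refine ⟨hy ▸ y.2, ?_⟩
    have e2 : A ⟨P x, hy ▸ y.2⟩ = A y := by congr 1; exact Subtype.ext hy.symm
    rw [e2, LinearPMap.map_smul, LinearPMap.map_add, e]
    simp only [sub_apply, smul_apply, one_apply_eq_self, add_sub_cancel]
    rw [smul_smul, inv_mul_cancel₀ two_ne_zero, one_smul]
  have hW : A.domain.map P.toLinearMap ≤ V := by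
    rintro _ ⟨x, -, rfl⟩
    exact V.starProjection_apply_mem x
  have : FiniteDimensional ℂ (A.domain.map P.toLinearMap) := Submodule.finiteDimensional_of_le hW
  have hcl : IsClosed (A.domain.map P.toLinearMap : Set H) := Submodule.closed_of_finiteDimensional _
  have hall : ∀ x : H, P x ∈ (A.domain.map P.toLinearMap : Set H) := by
    intro x
    have h1 : (A.domain : Set H) ⊆ P ⁻¹' (A.domain.map P.toLinearMap : Set H) :=
      fun x hx => ⟨x, hx, rfl⟩
    have h2 := (hcl.preimage P.continuous).closure_subset_iff.2 h1
    rw [hA.2.1.closure_eq] at h2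
    exact h2 (Set.mem_univ x)
  obtain ⟨x, hx, e⟩ := hall v
  have e' : P x = v := e.trans (Submodule.starProjection_eq_self_iff.2 hv)
  obtain ⟨h, e1⟩ := key ⟨x, hx⟩
  simp only at h e1
  subst e'
  exact ⟨h, by rw [e1]; exact V.starProjection_apply_mem _⟩

end Reduction

/-! ### The global symbol as the matrix of A on each block -/

section Symbol

variable {G : Type*} [Group G] [TopologicalSpace G] [IsTopologicalGroup G] [CompactSpace G]
  [MeasurableSpace G] [BorelSpace G] {μ : Measure G} [μ.IsHaarMeasure] [IsProbabilityMeasure μ]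

theorem IrredUnitaryRep.starProjection_coeffSpace_mem_commutant (ξ : IrredUnitaryRep G) :
    (ξ.coeffSpace μ).starProjection ∈ (rightGroupVNA μ).commutant :=
  (ξ.isRightInvariant_coeffSpace μ).starProjection_mem_commutant

theorem IsAffiliated.hasGlobalSymbol {A : Lp ℂ 2 μ →ₗ.[ℂ] Lp ℂ 2 μ}
    (hA : IsAffiliated (rightGroupVNA μ) A) (ξ : IrredUnitaryRep G) : HasGlobalSymbol A ξ := by
  intro i j
  obtain ⟨h, h'⟩ := hA.mem_domain_of_starProjection_mem (ξ.coeffSpace μ)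
    ξ.starProjection_coeffSpace_mem_commutant (ξ.coeff_mem_coeffSpace μ i j)
  exact ⟨h, ξ.exists_continuous_of_mem_coeffSpace μ h'⟩

/-- A matrix of continuous functions that transforms under left translations like `ξ` is of the
form `ξ σ` with a constant matrix `σ`. -/
theorem IrredUnitaryRep.eq_sum_of_leftShift (ξ : IrredUnitaryRep G)
    (φ : Fin ξ.dim → Fin ξ.dim → C(G, ℂ))
    (h : ∀ g i j, leftShift μ g (ContinuousMap.toLp 2 μ ℂ (φ i j)) =
      ∑ k, ξ.mat g i k • ContinuousMap.toLp 2 μ ℂ (φ k j)) (i j : Fin ξ.dim) :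
    ContinuousMap.toLp 2 μ ℂ (φ i j) = ∑ k, φ k j 1 • ξ.coeff μ i k := by
  have h1 : φ i j = ∑ k, φ k j 1 • ξ.matCoeff i k := by
    ext g
    have h2 : leftTranslate g (φ i j) = ∑ k, ξ.mat g i k • φ k j := by
      refine ContinuousMap.toLp_injective (p := 2) (𝕜 := ℂ) μ ?_
      rw [← leftShift_toLp, h, map_sum]
      simp only [map_smul]
    have h3 := congrArg (fun ψ : C(G, ℂ) => ψ 1) h2
    simp only [ContinuousMap.sum_apply] at h3
    have e : leftTranslate g (φ i j) 1 = φ i j g := congrArg (φ i j) (mul_one g)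
    rw [← e, h3, ContinuousMap.sum_apply]
    exact Finset.sum_congr rfl fun k _ => mul_comm _ _
  rw [h1, map_sum]
  simp only [map_smul, IrredUnitaryRep.coeff_eq]

theorem evalAtOne_toLp (φ : C(G, ℂ)) : evalAtOne (ContinuousMap.toLp 2 μ ℂ φ) = φ 1 := by
  have h : ∃ ψ : C(G, ℂ), ContinuousMap.toLp 2 μ ℂ ψ = ContinuousMap.toLp 2 μ ℂ φ := ⟨φ, rfl⟩
  rw [evalAtOne, dif_pos h]
  exact congrArg (fun ψ : C(G, ℂ) => ψ 1)
    (ContinuousMap.toLp_injective (p := 2) (𝕜 := ℂ) μ h.choose_spec)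

/-- A commutes with left translations, so Aξ transforms under them like ξ and is ξ times its value
at the identity. -/
theorem IsAffiliated.apply_coeff {A : Lp ℂ 2 μ →ₗ.[ℂ] Lp ℂ 2 μ}
    (hA : IsAffiliated (rightGroupVNA μ) A) (ξ : IrredUnitaryRep G) (i j : Fin ξ.dim)
    (hd : ξ.coeff μ i j ∈ A.domain) :
    A ⟨ξ.coeff μ i j, hd⟩ = ∑ k, globalSymbol A ξ k j • ξ.coeff μ i k := by
  choose h φ hφ using hA.hasGlobalSymbol ξ
  have hσ : ∀ k j, globalSymbol A ξ k j = φ k j 1 := by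
    intro k j
    rw [globalSymbol, ξ.mat_one, Matrix.conjTranspose_one, Matrix.one_mul, Matrix.of_apply,
      applyOrZero, dif_pos (h k j), hφ, evalAtOne_toLp]
  simp only [hσ]
  rw [hφ]
  refine ξ.eq_sum_of_leftShift φ (fun g i j => ?_) i j
  obtain ⟨h', e⟩ := hA.2.2 _ (leftShift_mem_commutant μ g) (leftShift_mem_unitary μ g)
    ⟨_, h i j⟩
  rw [← hφ, ← e]
  let y : A.domain := ∑ k, ξ.mat g i k • ⟨ξ.coeff μ k j, h k j⟩
  have hy : (⟨leftShift μ g (ξ.coeff μ i j), h'⟩ : A.domain) = y := by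
    apply Subtype.ext
    rw [AddSubmonoidClass.coe_finsetSum]
    exact ξ.leftShift_coeff μ g i j
  rw [hy, ← LinearPMap.toFun_eq_coe, map_sum]
  refine Finset.sum_congr rfl fun k _ => ?_
  rw [map_smul, LinearPMap.toFun_eq_coe, hφ]

/-- In coefficient coordinates A multiplies each row by σ, and by orthogonality the L² norm is the
Euclidean norm of the coordinates up to the common factor d_ξ^{-1/2}. -/
theorem IsAffiliated.norm_apply_le {A : Lp ℂ 2 μ →ₗ.[ℂ] Lp ℂ 2 μ}
    (hA : IsAffiliated (rightGroupVNA μ) A) (ξ : IrredUnitaryRep G) {v : Lp ℂ 2 μ}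
    (hv : v ∈ ξ.coeffSpace μ) :
    ∃ h : v ∈ A.domain,
      ‖A ⟨v, h⟩‖ ≤ ‖Matrix.toEuclideanCLM (𝕜 := ℂ) (globalSymbol A ξ)‖ * ‖v‖ := by
  set σ := globalSymbol A ξ
  set N := ‖Matrix.toEuclideanCLM (𝕜 := ℂ) σ‖
  obtain ⟨hvd, -⟩ := hA.mem_domain_of_starProjection_mem (ξ.coeffSpace μ)
    ξ.starProjection_coeffSpace_mem_commutant hv
  refine ⟨hvd, ?_⟩
  choose hd φ hφ using hA.hasGlobalSymbol ξ
  let a : Fin ξ.dim → Fin ξ.dim → ℂ := fun i j => (ξ.dim : ℂ) * inner ℂ (ξ.coeff μ i j) v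
  have hva : v = ∑ i, ∑ j, a i j • ξ.coeff μ i j := by
    rw [← ξ.starProjection_coeffSpace_apply μ v, eq_comm]
    exact Submodule.starProjection_eq_self_iff.2 hv
  let y : A.domain := ∑ i, ∑ j, a i j • ⟨ξ.coeff μ i j, hd i j⟩
  have hy : (⟨v, hvd⟩ : A.domain) = y := by
    apply Subtype.ext
    simp only [y, AddSubmonoidClass.coe_finsetSum]
    exact hva
  have hAv : A ⟨v, hvd⟩ = ∑ i, ∑ k, (σ *ᵥ a i) k • ξ.coeff μ i k := by
    rw [hy, ← LinearPMap.toFun_eq_coe, map_sum]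
    refine Finset.sum_congr rfl fun i _ => ?_
    simp only [map_sum, map_smul, LinearPMap.toFun_eq_coe, hA.apply_coeff, Finset.smul_sum]
    rw [Finset.sum_comm]
    refine Finset.sum_congr rfl fun k _ => ?_
    rw [Matrix.mulVec, dotProduct, Finset.sum_smul]
    refine Finset.sum_congr rfl fun j _ => ?_
    rw [smul_smul, mul_comm]
  have hrow : ∀ i, ∑ k, ‖(σ *ᵥ a i) k‖ ^ 2 ≤ N ^ 2 * ∑ j, ‖a i j‖ ^ 2 := by
    intro i
    have h1 := (Matrix.toEuclideanCLM (𝕜 := ℂ) σ).le_opNorm (WithLp.toLp 2 (a i))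
    have h2 : ‖Matrix.toEuclideanCLM (𝕜 := ℂ) σ (WithLp.toLp 2 (a i))‖ ^ 2 ≤
        (N * ‖(WithLp.toLp 2 (a i) : EuclideanSpace ℂ (Fin ξ.dim))‖) ^ 2 := by gcongr
    rwa [mul_pow, EuclideanSpace.norm_sq_eq, EuclideanSpace.norm_sq_eq,
      Matrix.ofLp_toEuclideanCLM] at h2
  rw [← sq_le_sq₀ (norm_nonneg _) (by positivity), mul_pow, hAv, hva, ξ.norm_sum_coeff_sq μ,
    ξ.norm_sum_coeff_sq μ, mul_left_comm]
  refine mul_le_mul_of_nonneg_left ?_ (by positivity)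
  rw [Finset.mul_sum]
  exact Finset.sum_le_sum fun i _ => hrow i

end Symbol

/-! ### Inversion invariance and convolution with coefficients -/

section Convolution

variable {G : Type*} [Group G] [TopologicalSpace G] [IsTopologicalGroup G] [CompactSpace G]
  [MeasurableSpace G] [BorelSpace G] (μ : Measure G) [μ.IsHaarMeasure] [IsProbabilityMeasure μ]

/-- Inversion turns the right invariance of Haar measure into left invariance of the image, so
uniqueness applies. -/
theorem measurePreserving_inv_of_compact : MeasurePreserving (fun x : G => x⁻¹) μ μ := by
  have hm : Measurable (fun x : G => x⁻¹) := continuous_inv.measurable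
  have h1 : IsProbabilityMeasure (μ.map (fun x : G => x⁻¹)) :=
    Measure.isProbabilityMeasure_map hm.aemeasurable
  have h2 : (μ.map (fun x : G => x⁻¹)).IsMulLeftInvariant := by
    refine ⟨fun g => ?_⟩
    rw [Measure.map_map (continuous_const_mul g).measurable hm]
    have e : (fun x : G => g * x) ∘ (fun x : G => x⁻¹) = (fun x : G => x⁻¹) ∘ (fun x => x * g⁻¹) := by
      ext x; simp
    rw [e, ← Measure.map_map hm (continuous_mul_const _).measurable,
      (measurePreserving_mul_right_of_compact μ g⁻¹).map_eq]
  have h3 : (μ.map (fun x : G => x⁻¹)).IsHaarMeasure :=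
    Measure.isHaarMeasure_of_isCompact_nonempty_interior _ Set.univ isCompact_univ (by simp)
      (by simp) (by simp)
  exact ⟨hm, Measure.isHaarMeasure_eq_of_isProbabilityMeasure _ μ⟩

theorem measurePreserving_inv_mul_of_compact (x : G) :
    MeasurePreserving (fun y : G => y⁻¹ * x) μ μ :=
  (measurePreserving_mul_right_of_compact μ x).comp (measurePreserving_inv_of_compact μ)

theorem integrable_mul_toContinuousMap (h : Lp ℂ 2 μ) {F : G → ℂ} (hF : Continuous F) :
    Integrable (fun y => h y * F y) μ := by
  have hh : Integrable h μ := (Lp.memLp h).integrable (by norm_num)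
  obtain ⟨C, hC⟩ := isCompact_univ.exists_bound_of_continuousOn hF.continuousOn
  exact hh.mul_bdd (c := C) hF.aestronglyMeasurable (.of_forall fun x => hC x (Set.mem_univ x))

theorem integral_mul_matCoeff (ξ : IrredUnitaryRep G) (i k : Fin ξ.dim) (h : Lp ℂ 2 μ) (x : G) :
    ∫ y, h y * ξ.matCoeff i k (y⁻¹ * x) ∂μ =
      ∑ l, inner ℂ (ξ.coeff μ l i) h * ξ.mat x l k := by
  have h1 : ∀ y, h y * ξ.matCoeff i k (y⁻¹ * x) =
      ∑ l, h y * star (ξ.mat y l i) * ξ.mat x l k := by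
    intro y
    change h y * ξ.mat (y⁻¹ * x) i k = _
    rw [ξ.mat_mul, Matrix.mul_apply, Finset.mul_sum]
    refine Finset.sum_congr rfl fun l _ => ?_
    rw [ξ.mat_inv_apply, mul_assoc]
  simp only [h1]
  rw [integral_finsetSum]
  · refine Finset.sum_congr rfl fun l _ => ?_
    rw [integral_mul_const]
    congr 1
    rw [L2.inner_def]
    refine integral_congr_ae ?_
    filter_upwards [ContinuousMap.coeFn_toLp (p := 2) (𝕜 := ℂ) μ (ξ.matCoeff l i)] with y hy
    rw [ξ.coeff_eq μ, hy, RCLike.inner_apply]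
    rfl
  · intro l _
    refine (integrable_mul_toContinuousMap μ h ?_).mul_const _
    exact (ξ.continuous_mat_apply l i).star

end Convolution

/-! ### Plancherel trace of spectral projections and the main estimate -/

section Trace

theorem UnitaryDual.eq_of_rep_equivalent {G : Type*} [Group G] [TopologicalSpace G]
    {c c' : UnitaryDual G} (h : c.rep.Equivalent c'.rep) : c = c' := by
  have := Quotient.sound (s := IrredUnitaryRep.setoid G) h
  exact (Quotient.out_eq c).symm.trans (this.trans (Quotient.out_eq c'))

theorem UnitaryDual.exists_equivalent_rep {G : Type*} [Group G] [TopologicalSpace G]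
    (ξ : IrredUnitaryRep G) : ∃ c : UnitaryDual G, ξ.Equivalent c.rep :=
  ⟨Quotient.mk (IrredUnitaryRep.setoid G) ξ,
    Quotient.exact (s := IrredUnitaryRep.setoid G) (Quotient.out_eq _).symm⟩

variable {G : Type*} [Group G] [TopologicalSpace G] [IsTopologicalGroup G] [CompactSpace G]
  [T2Space G] [SecondCountableTopology G]
  [MeasurableSpace G] [BorelSpace G] (μ : Measure G) [μ.IsHaarMeasure] [IsProbabilityMeasure μ]

theorem eq_zero_of_forall_unitaryDual {v : Lp ℂ 2 μ}
    (hv : ∀ c : UnitaryDual G, ∀ u ∈ c.rep.coeffSpace μ, inner ℂ u v = 0) : v = 0 := by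
  refine eq_zero_of_mem_orthogonal_coeffSpace μ fun ξ => ?_
  obtain ⟨c, hc⟩ := UnitaryDual.exists_equivalent_rep ξ
  have hle : ξ.coeffSpace μ ≤ c.rep.coeffSpace μ := by
    refine Submodule.span_le.2 ?_
    rintro _ ⟨ij, rfl⟩
    exact hc.coeff_mem_coeffSpace μ _ _
  rw [Submodule.mem_orthogonal]
  exact fun u hu => hv c u (hle hu)

/-- The component at `ξ` of the Dirichlet kernel, `d_ξ` times the character of `ξ`. -/
noncomputable def IrredUnitaryRep.dirichlet (ξ : IrredUnitaryRep G) : Lp ℂ 2 μ :=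
  (ξ.dim : ℂ) • ∑ i, ξ.coeff μ i i

theorem IrredUnitaryRep.dirichlet_mem (ξ : IrredUnitaryRep G) :
    ξ.dirichlet μ ∈ ξ.coeffSpace μ :=
  Submodule.smul_mem _ _ (Submodule.sum_mem _ fun i _ => ξ.coeff_mem_coeffSpace μ i i)

theorem IrredUnitaryRep.norm_dirichlet_sq (ξ : IrredUnitaryRep G) :
    ‖ξ.dirichlet μ‖ ^ 2 = (ξ.dim : ℝ) ^ 2 := by
  have h : ξ.dirichlet μ = ∑ i, ∑ j, (if i = j then (ξ.dim : ℂ) else 0) • ξ.coeff μ i j := by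
    simp [dirichlet, Finset.smul_sum, ite_smul]
  rw [h, ξ.norm_sum_coeff_sq μ]
  have hd : (ξ.dim : ℝ) ≠ 0 := by exact_mod_cast ξ.dim_pos.ne'
  simp only [apply_ite (fun z : ℂ => ‖z‖ ^ 2), Complex.norm_natCast, norm_zero, ne_eq,
    OfNat.ofNat_ne_zero, not_false_eq_true, zero_pow, Finset.sum_ite_eq, Finset.mem_univ, if_true,
    Finset.sum_const, Finset.card_univ, Fintype.card_fin, nsmul_eq_mul]
  field_simp

theorem norm_sum_dirichlet_sq (D : Finset (UnitaryDual G)) :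
    ‖∑ c ∈ D, c.rep.dirichlet μ‖ ^ 2 = ∑ c ∈ D, (c.rep.dim : ℝ) ^ 2 := by
  classical
  induction D using Finset.induction_on with
  | empty => simp
  | insert c D hc ih =>
    rw [Finset.sum_insert hc, Finset.sum_insert hc, ← ih, ← c.rep.norm_dirichlet_sq μ]
    have h0 : inner ℂ (c.rep.dirichlet μ) (∑ c ∈ D, c.rep.dirichlet μ) = 0 := by
      rw [inner_sum]
      refine Finset.sum_eq_zero fun c' hc' => ?_
      refine IrredUnitaryRep.inner_eq_zero_of_mem_coeffSpace μ (fun he => hc ?_)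
        (c.rep.dirichlet_mem μ) (c'.rep.dirichlet_mem μ)
      rwa [UnitaryDual.eq_of_rep_equivalent he]
    have := norm_add_sq_eq_norm_sq_add_norm_sq_of_inner_eq_zero _ _ h0
    simpa only [sq] using this

variable {μ}

theorem commute_apply_of_mem_rightGroupVNA {E T : Lp ℂ 2 μ →L[ℂ] Lp ℂ 2 μ}
    (hE : E ∈ rightGroupVNA μ) (hT : T ∈ (rightGroupVNA μ).commutant) (u : Lp ℂ 2 μ) :
    E (T u) = T (E u) := by
  rw [VonNeumannAlgebra.mem_commutant_iff] at hT
  exact DFunLike.congr_fun (hT E hE) u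

theorem apply_mem_coeffSpace_of_mem_rightGroupVNA {E : Lp ℂ 2 μ →L[ℂ] Lp ℂ 2 μ}
    (hE : E ∈ rightGroupVNA μ) (ξ : IrredUnitaryRep G) {u : Lp ℂ 2 μ} (hu : u ∈ ξ.coeffSpace μ) :
    E u ∈ ξ.coeffSpace μ := by
  have h := commute_apply_of_mem_rightGroupVNA hE
    (ξ.starProjection_coeffSpace_mem_commutant (μ := μ)) u
  rw [Submodule.starProjection_eq_self_iff.2 hu] at h
  rw [h]
  exact Submodule.starProjection_apply_mem _ _

theorem exists_apply_coeff_eq_of_mem_rightGroupVNA {E : Lp ℂ 2 μ →L[ℂ] Lp ℂ 2 μ}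
    (hE : E ∈ rightGroupVNA μ) (ξ : IrredUnitaryRep G) :
    ∃ Q : Fin ξ.dim → Fin ξ.dim → ℂ, ∀ i j, E (ξ.coeff μ i j) = ∑ k, Q k j • ξ.coeff μ i k := by
  choose φ hφ using fun i j => ξ.exists_continuous_of_mem_coeffSpace μ
    (apply_mem_coeffSpace_of_mem_rightGroupVNA hE ξ (ξ.coeff_mem_coeffSpace μ i j))
  refine ⟨fun k j => φ k j 1, fun i j => ?_⟩
  rw [hφ]
  refine ξ.eq_sum_of_leftShift φ (fun g i j => ?_) i j
  rw [← hφ, ← commute_apply_of_mem_rightGroupVNA hE (leftShift_mem_commutant μ g),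
    ξ.leftShift_coeff μ, map_sum]
  simp only [map_smul, hφ]

/-- By Peter–Weyl it suffices to pair with each block. Self-adjointness moves E onto the block,
which E either kills or preserves. -/
theorem apply_eq_sum_of_apply_eq_zero {E : Lp ℂ 2 μ →L[ℂ] Lp ℂ 2 μ}
    (hE : IsSelfAdjoint E) (hEM : E ∈ rightGroupVNA μ) (D : Finset (UnitaryDual G))
    (hD : ∀ c ∉ D, ∀ u ∈ c.rep.coeffSpace μ, E u = 0) (h : Lp ℂ 2 μ) :
    E h = ∑ c ∈ D, E ((c.rep.coeffSpace μ).starProjection h) := by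
  classical
  rw [← map_sum, ← sub_eq_zero, ← map_sub]
  refine eq_zero_of_forall_unitaryDual μ fun c u hu => ?_
  have hsymm : inner ℂ u (E (h - ∑ c ∈ D, (c.rep.coeffSpace μ).starProjection h)) =
      inner ℂ (E u) (h - ∑ c ∈ D, (c.rep.coeffSpace μ).starProjection h) :=
    ((ContinuousLinearMap.isSelfAdjoint_iff_isSymmetric.1 hE) u _).symm
  rw [hsymm]
  by_cases hc : c ∈ D
  · have hEu := apply_mem_coeffSpace_of_mem_rightGroupVNA hEM c.rep hu
    rw [inner_sub_right, inner_sum, Finset.sum_eq_single_of_mem c hc, ← inner_sub_right]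
    · exact Submodule.inner_right_of_mem_orthogonal hEu
        (Submodule.sub_starProjection_mem_orthogonal _)
    · intro c' _ hne
      refine IrredUnitaryRep.inner_eq_zero_of_mem_coeffSpace μ (fun he => hne ?_) hEu
        (Submodule.starProjection_apply_mem _ _)
      exact (UnitaryDual.eq_of_rep_equivalent he).symm
  · rw [hD c hc u hu, inner_zero_left]

/-- The kernel K reproduces the blocks in D under convolution, and E commutes with left
translations, so Eh = h * EK. A projection is its own square root, which makes EK admissible in the
infimum defining the trace. -/
theorem plancherelTrace_le {E : Lp ℂ 2 μ →L[ℂ] Lp ℂ 2 μ} (hE : IsStarProjection E)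
    (hEM : E ∈ rightGroupVNA μ) (D : Finset (UnitaryDual G))
    (hD : ∀ c ∉ D, ∀ u ∈ c.rep.coeffSpace μ, E u = 0) :
    plancherelTrace μ E ≤ ∑ c ∈ D, (c.rep.dim : ℝ≥0∞) ^ 2 := by
  choose Q hQ using fun c : UnitaryDual G => exists_apply_coeff_eq_of_mem_rightGroupVNA hEM c.rep
  set K : Lp ℂ 2 μ := ∑ c ∈ D, c.rep.dirichlet μ with hK
  -- An explicit continuous representative of EK, so that the convolution can be computed pointwise.
  let F : C(G, ℂ) := ∑ c ∈ D, ∑ i, ∑ k, ((c.rep.dim : ℂ) * Q c k i) • c.rep.matCoeff i k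
  have hEK : E K = ContinuousMap.toLp 2 μ ℂ F := by
    simp only [hK, F, map_sum, map_smul, IrredUnitaryRep.dirichlet, hQ, Finset.smul_sum, smul_smul,
      ← IrredUnitaryRep.coeff_eq]
  have hconv : ∀ h : Lp ℂ 2 μ,
      (opSqrt E h : G → ℂ) =ᵐ[μ] fun x => ∫ y, h y * (E K) (y⁻¹ * x) ∂μ := by
    intro h
    have h1 : ∀ x, ∫ y, h y * (E K) (y⁻¹ * x) ∂μ = ∫ y, h y * F (y⁻¹ * x) ∂μ := by
      intro x
      refine integral_congr_ae ?_
      have h2 : (E K : G → ℂ) =ᵐ[μ] F := by rw [hEK]; exact ContinuousMap.coeFn_toLp μ F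
      filter_upwards [(measurePreserving_inv_mul_of_compact μ x).quasiMeasurePreserving.ae_eq_comp h2]
        with y hy
      rw [show (E K) (y⁻¹ * x) = F (y⁻¹ * x) from hy]
    let F' : C(G, ℂ) := ∑ c ∈ D, ∑ l, ∑ i, ∑ k,
      ((c.rep.dim : ℂ) * inner ℂ (c.rep.coeff μ l i) h * Q c k i) • c.rep.matCoeff l k
    have h3 : opSqrt E h = ContinuousMap.toLp 2 μ ℂ F' := by
      rw [opSqrt_of_isStarProjection hE,
        apply_eq_sum_of_apply_eq_zero hE.isSelfAdjoint hEM D hD h]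
      simp only [IrredUnitaryRep.starProjection_coeffSpace_apply, F', map_sum, map_smul, hQ,
        Finset.smul_sum, smul_smul, ← IrredUnitaryRep.coeff_eq]
    rw [h3]
    filter_upwards [ContinuousMap.coeFn_toLp (p := 2) (𝕜 := ℂ) μ F'] with x hx
    rw [hx, h1]
    have h4 : ∀ y, h y * F (y⁻¹ * x) = ∑ c ∈ D, ∑ i, ∑ k, ((c.rep.dim : ℂ) * Q c k i) *
        (h y * c.rep.matCoeff i k (y⁻¹ * x)) := by
      intro y
      simp only [F, ContinuousMap.sum_apply, ContinuousMap.smul_apply, Finset.mul_sum, smul_eq_mul]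
      refine Finset.sum_congr rfl fun c _ => Finset.sum_congr rfl fun i _ =>
        Finset.sum_congr rfl fun k _ => ?_
      ring
    have hint : ∀ (c : UnitaryDual G) i k, Integrable (fun y => ((c.rep.dim : ℂ) * Q c k i) *
        (h y * c.rep.matCoeff i k (y⁻¹ * x))) μ := fun c i k =>
      (integrable_mul_toContinuousMap μ h (F := fun y => c.rep.matCoeff i k (y⁻¹ * x))
        (by fun_prop)).const_mul _
    simp only [h4]
    rw [integral_finsetSum _ fun c _ => integrable_finsetSum _ fun i _ =>
      integrable_finsetSum _ fun k _ => hint c i k]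
    simp only [F', ContinuousMap.sum_apply, ContinuousMap.smul_apply, smul_eq_mul]
    refine Finset.sum_congr rfl fun c _ => ?_
    rw [integral_finsetSum _ fun i _ => integrable_finsetSum _ fun k _ => hint c i k,
      Finset.sum_comm]
    refine Finset.sum_congr rfl fun i _ => ?_
    rw [integral_finsetSum _ fun k _ => hint c i k, Finset.sum_comm]
    refine Finset.sum_congr rfl fun k _ => ?_
    rw [integral_const_mul, integral_mul_matCoeff, Finset.mul_sum]
    refine Finset.sum_congr rfl fun l _ => ?_
    change _ * c.rep.mat x l k = _
    ring
  refine (iInf₂_le (E K) hconv).trans ?_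
  have h5 : ‖E K‖ ≤ ‖K‖ := by
    refine (E.le_opNorm K).trans ?_
    exact mul_le_of_le_one_left (norm_nonneg _) (IsStarProjection.norm_le E hE)
  calc ENNReal.ofReal (‖E K‖ ^ 2) ≤ ENNReal.ofReal (‖K‖ ^ 2) := by gcongr
    _ = ∑ c ∈ D, (c.rep.dim : ℝ≥0∞) ^ 2 := by
      rw [norm_sum_dirichlet_sq, ENNReal.ofReal_sum_of_nonneg fun c _ => by positivity]
      refine Finset.sum_congr rfl fun c _ => ?_
      rw [ENNReal.ofReal_pow (by positivity), ENNReal.ofReal_natCast]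

/-- The trace of `E_{(l,∞)}(|A|)` is at most the sum of `d_ξ²` over all `ξ` with
`‖σ_A(ξ)‖ ≥ l`. -/
theorem IsAffiliated.plancherelTrace_modulusSpectralProjIoi_le {A : Lp ℂ 2 μ →ₗ.[ℂ] Lp ℂ 2 μ}
    (hA : IsAffiliated (rightGroupVNA μ) A) (l : ℝ≥0) :
    plancherelTrace μ (modulusSpectralProjIoi A l) ≤
      ∑' c : {c : UnitaryDual G // (l : ℝ) ≤ symbolNorm A c}, (c.1.rep.dim : ℝ≥0∞) ^ 2 := by
  by_cases hfin : ∑' c : {c : UnitaryDual G // (l : ℝ) ≤ symbolNorm A c},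
      (c.1.rep.dim : ℝ≥0∞) ^ 2 = ⊤
  · rw [hfin]; exact le_top
  -- Every term d_ξ² is at least 1, so a finite sum has finitely many terms.
  have hS : Set.Finite {c : UnitaryDual G | (l : ℝ) ≤ symbolNorm A c} := by
    have h1 := ENNReal.finite_const_le_of_tsum_ne_top hfin one_ne_zero
    have h2 : {i : {c : UnitaryDual G // (l : ℝ) ≤ symbolNorm A c} |
        1 ≤ (i.1.rep.dim : ℝ≥0∞) ^ 2} = Set.univ := by
      refine Set.eq_univ_of_forall fun i => ?_
      have : (1 : ℝ≥0∞) ≤ i.1.rep.dim := by exact_mod_cast i.1.rep.dim_pos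
      exact one_le_pow₀ this
    rw [h2, Set.finite_univ_iff] at h1
    exact h1
  have hR := isInvOneAddAdjMul_invOneAddAdjMul hA.1 hA.2.1
  have hmem : modulusSpectralProjIoi A l ∈ rightGroupVNA μ :=
    spectralProjIoi_mem (fun T hT =>
      (Commute.one_left T).sub_left (hA.commute_invOneAddAdjMul hT)) _
  refine (plancherelTrace_le (isStarProjection_spectralProjIoi _ _) hmem hS.toFinset ?_).trans ?_
  · intro c hc u hu
    have hc' : symbolNorm A c < l := by simpa using hc
    have h := hR.spectralProjIoi_apply_eq_zero hA.2.1 (l := l)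
      (hA.commute_invOneAddAdjMul (c.rep.starProjection_coeffSpace_mem_commutant (μ := μ)))
      (fun v => by
        obtain ⟨hd, hle⟩ := hA.norm_apply_le c.rep
          (Submodule.starProjection_apply_mem (c.rep.coeffSpace μ) v)
        exact ⟨hd, hle.trans (by gcongr; exact hc'.le)⟩) u
    rwa [Submodule.starProjection_eq_self_iff.2 hu] at h
  · have : Fintype {c : UnitaryDual G // (l : ℝ) ≤ symbolNorm A c} := hS.fintype
    rw [tsum_fintype]
    exact (Finset.sum_subtype hS.toFinset (fun c => hS.mem_toFinset)
      fun c => (c.rep.dim : ℝ≥0∞) ^ 2).le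

/-- Writing N for the sum of d_ξ² over ‖σ_A(ξ)‖ ≥ s, the bound s N^a ≤ M ≤ s t^a gives N ≤ t after
cancelling s and taking roots. -/
theorem IsAffiliated.plancherelTrace_modulusSpectralProjIoi_le_ofReal
    {A : Lp ℂ 2 μ →ₗ.[ℂ] Lp ℂ 2 μ} (hA : IsAffiliated (rightGroupVNA μ) A) {a : ℝ} (ha : 0 < a)
    (hfin : symbolBound A a ≠ ⊤) {s : ℝ≥0} (hs : 0 < s) {t : ℝ} (ht : 0 < t)
    (hst : (symbolBound A a).toReal ≤ s * t ^ a) :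
    plancherelTrace μ (modulusSpectralProjIoi A s) ≤ ENNReal.ofReal t := by
  refine (hA.plancherelTrace_modulusSpectralProjIoi_le s).trans ?_
  have hs' : (0 : ℝ) < s := hs
  have h1 : ENNReal.ofReal (s : ℝ) * (∑' c : {c : UnitaryDual G // (s : ℝ) ≤ symbolNorm A c},
      (c.1.rep.dim : ℝ≥0∞) ^ 2) ^ a ≤ symbolBound A a :=
    le_iSup₂ (f := fun (s : ℝ) (_ : 0 < s) => ENNReal.ofReal s *
      (∑' c : {c : UnitaryDual G // s ≤ symbolNorm A c}, (c.1.rep.dim : ℝ≥0∞) ^ 2) ^ a) (s : ℝ) hs'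
  have h2 : symbolBound A a ≤ ENNReal.ofReal (s : ℝ) * ENNReal.ofReal t ^ a := by
    rw [ENNReal.ofReal_rpow_of_pos ht, ← ENNReal.ofReal_mul hs'.le]
    exact (ENNReal.le_ofReal_iff_toReal_le hfin (by positivity)).2 hst
  have h3 := (ENNReal.mul_le_mul_iff_right (by simpa using hs.ne') ENNReal.ofReal_ne_top).1
    (h1.trans h2)
  exact (ENNReal.rpow_le_rpow_iff ha).1 h3

theorem IsAffiliated.weakLorentzNorm_le_symbolBound {A : Lp ℂ 2 μ →ₗ.[ℂ] Lp ℂ 2 μ}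
    (hA : IsAffiliated (rightGroupVNA μ) A) {r a : ℝ} (ha : 0 < a) (hr : 1 / r = a) :
    weakLorentzNorm (plancherelTrace μ) r A ≤ symbolBound A a := by
  by_cases hfin : symbolBound A a = ⊤
  · rw [hfin]; exact le_top
  refine iSup₂_le fun t ht => ?_
  rw [hr]
  have hta : 0 < t ^ a := Real.rpow_pos_of_pos ht a
  refine ENNReal.le_of_forall_pos_le_add fun ε hε _ => ?_
  set M := (symbolBound A a).toReal with hM
  have hM0 : 0 ≤ M := ENNReal.toReal_nonneg
  have hε' : (0 : ℝ) < ε := hε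
  -- The ε keeps s positive even when M = 0, as the supremum runs over s > 0 only.
  let s : ℝ≥0 := ⟨(M + ε) / t ^ a, by positivity⟩
  have hsv : (s : ℝ) = (M + ε) / t ^ a := rfl
  have hs : 0 < s := by
    have : (0 : ℝ) < s := by rw [hsv]; positivity
    exact this
  have hst : (s : ℝ) * t ^ a = M + ε := by rw [hsv]; field_simp
  have h1 : singularNumber (plancherelTrace μ) A t ≤ s :=
    iInf₂_le s (hA.plancherelTrace_modulusSpectralProjIoi_le_ofReal ha hfin hs ht
      (by rw [hst]; linarith))
  calc ENNReal.ofReal (t ^ a) * singularNumber (plancherelTrace μ) A t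
      ≤ ENNReal.ofReal (t ^ a) * ENNReal.ofReal s := by
        gcongr; rwa [ENNReal.ofReal_coe_nnreal]
    _ = ENNReal.ofReal (M + ε) := by rw [← ENNReal.ofReal_mul hta.le, mul_comm, hst]
    _ = symbolBound A a + ε := by
      rw [ENNReal.ofReal_add hM0 hε'.le, hM, ENNReal.ofReal_toReal hfin, ENNReal.ofReal_coe_nnreal]

/-- The projection 1 - E_{(s,∞)}(|A|) has range in the domain, and the trace of its complement is
small once s is large. -/
theorem IsAffiliated.isLeftFourierMultiplier {A : Lp ℂ 2 μ →ₗ.[ℂ] Lp ℂ 2 μ}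
    (hA : IsAffiliated (rightGroupVNA μ) A) {a : ℝ} (ha : 0 < a) (hfin : symbolBound A a ≠ ⊤) :
    IsLeftFourierMultiplier μ A := by
  refine ⟨hA, fun ε hε => ?_⟩
  have hεa : 0 < ε ^ a := Real.rpow_pos_of_pos hε a
  set M := (symbolBound A a).toReal with hM
  have hM0 : 0 ≤ M := ENNReal.toReal_nonneg
  let s : ℝ≥0 := ⟨(M + 1) / ε ^ a, by positivity⟩
  have hsv : (s : ℝ) = (M + 1) / ε ^ a := rfl
  have hs : 0 < s := by
    have : (0 : ℝ) < s := by rw [hsv]; positivity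
    exact this
  have hst : (s : ℝ) * ε ^ a = M + 1 := by rw [hsv]; field_simp
  have hE : IsStarProjection (modulusSpectralProjIoi A s) := isStarProjection_spectralProjIoi _ _
  have hmem : modulusSpectralProjIoi A s ∈ rightGroupVNA μ :=
    spectralProjIoi_mem (fun T hT =>
      (Commute.one_left T).sub_left (hA.commute_invOneAddAdjMul hT)) _
  refine ⟨1 - modulusSpectralProjIoi A s, sub_mem (one_mem _) hmem, hE.one_sub, fun x => ?_, ?_⟩
  · refine (isInvOneAddAdjMul_invOneAddAdjMul hA.1
      hA.2.1).mem_domain_of_spectralProjIoi_apply_eq_zero hA.2.1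
      (a := (s : ℝ) ^ 2 / (1 + (s : ℝ) ^ 2)) ?_ ?_
    · rw [div_lt_one (by positivity)]; linarith
    · exact DFunLike.congr_fun hE.isIdempotentElem.mul_one_sub_self x
  · rw [sub_sub_cancel]
    exact hA.plancherelTrace_modulusSpectralProjIoi_le_ofReal ha hfin hs hε
      (by rw [hst]; linarith)

end Trace

theorem proposition4
    {E : Type*} [NormedAddCommGroup E] [NormedSpace ℝ E] [FiniteDimensional ℝ E]
    {G : Type*} [Group G] [TopologicalSpace G] [IsTopologicalGroup G] [T2Space G] [CompactSpace G]
    [ChartedSpace E G] [LieGroup (modelWithCornersSelf ℝ E) ∞ G]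
    [MeasurableSpace G] [BorelSpace G]
    (μ : Measure G) [μ.IsHaarMeasure] [IsProbabilityMeasure μ]
    (p q r : ℝ) (hp : 1 < p) (hp2 : p ≤ 2) (hq : 2 ≤ q) (hpq : p ≠ q) (hr : 1 / r = 1 / p - 1 / q)
    (A : Lp ℂ 2 μ →ₗ.[ℂ] Lp ℂ 2 μ) (hA : IsAffiliated (rightGroupVNA μ) A) :
    (∀ ξ : IrredUnitaryRep G, HasGlobalSymbol A ξ) ∧
    (symbolBound A (1 / p - 1 / q) < ⊤ → IsLeftFourierMultiplier μ A) ∧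
    weakLorentzNorm (plancherelTrace μ) r A ≤ symbolBound A (1 / p - 1 / q) := by
  -- A compact manifold modelled on a finite dimensional space is second countable, as the
  -- Peter–Weyl argument requires.
  have : SecondCountableTopology E := inferInstance
  have : SecondCountableTopology G := ChartedSpace.secondCountable_of_sigmaCompact E G
  have ha : 0 < 1 / p - 1 / q := by
    have h1 : p < q := lt_of_le_of_ne (hp2.trans hq) hpq
    exact sub_pos.2 (one_div_lt_one_div_of_lt (by linarith) h1)
  exact ⟨hA.hasGlobalSymbol, fun h => hA.isLeftFourierMultiplier ha h.ne,
    hA.weakLorentzNorm_le_symbolBound ha hr⟩
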